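/- Let $d\ge 1$, let $\Omega\subset\mathbb R^d$ be a bounded open set (for instance a bounded Lipschitz polytopal domain with $d\in\{1,2,3\}$), let $T>0$ and $Q_T=\Omega\times(0,T)$. Let $c\in L^\infty(\Omega)$ with $c\ge c_0>0$ almost everywhere in $\Omega$, and let $C_\Omega>0$ be a constant in the Poincaré inequality $\|v\|_{L^2(\Omega)}\le C_\Omega\|\nabla v\|_{L^2(\Omega)}$ for all $v\in H^1_0(\Omega)$. The Newton potential $\mathcal N^\Omega:[H_0^1(\Omega)]'\to H_0^1(\Omega)$ is defined by $(c^2\nabla\mathcal N^\Omega f,\nabla v)_{L^2(\Omega)}=\langle f,v\rangle$ for all $v\in H^1_0(\Omega)$, with $\|f\|_{\mathcal N^\Omega}^2:=\langle f,\mathcal N^\Omega f\rangle$; it acts pointwise in time on functions with values in $[H^1_0(\Omega)]'$, and $f\in L^2(\Omega)$ is regarded as the functional $\langle f,v\rangle=(f,v)_{L^2(\Omega)}$. The subscript $e$ denotes integration in time against $e^{-t/T}$: $(\chi,\lambda)_{L^2_e(Q_T)}=\int_0^T(\chi(t),\lambda(t))_{L^2(\Omega)}e^{-t/T}\,dt$,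 $\langle f,\lambda\rangle_e=\int_0^T\langle f(t),\lambda(t)\rangle e^{-t/T}\,dt$ and $\|f\|_{\mathcal N^\Omega_e}^2=\int_0^T\|f(t)\|_{\mathcal N^\Omega}^2e^{-t/T}\,dt$. Define $$\mathcal A((U,V),(\lambda,\chi)):=\langle\partial_tV,\lambda\rangle_e+(c^2\nabla U,\nabla\lambda)_{L^2_e(Q_T)}-(\partial_tU,\chi)_{L^2_e(Q_T)}+(V,\chi)_{L^2_e(Q_T)},$$ $$\|(U,V)\|_{\mathcal V_e}^2:=\|\partial_tU\|_{L^2_e(Q_T)}^2+\|\partial_tV\|_{\mathcal N^\Omega_e}^2+\|c\nabla U\|_{L^2_e(Q_T)}^2+\|V\|_{L^2_e(Q_T)}^2,\qquad \|(\lambda,\chi)\|_{\mathcal W_e}^2:=\|\lambda\|_{L^2_e(Q_T)}^2+\|\chi\|_{\mathcal N^\Omega_e}^2 .$$ For a Hilbert space $X$ let $H^1_{0,\bullet}(0,T;X)=\{u\in H^1(0,T;X):u(0)=0\}$. Then for every $(U,V)\in H^1_{0,\bullet}(0,T;H^1_0(\Omega))\times H^1_{0,\bullet}(0,T;L^2(\Omega))$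 with $(U,V)\ne(0,0)$, the pair $(\lambda,\chi)\in L^2(0,T;H^1_0(\Omega))\times L^2(Q_T)$ given by $$\chi=-\partial_tU+2T\,\partial_tV,\qquad \lambda=\mathcal N^\Omega\partial_tV+2T\,\partial_tU$$ satisfies $\|(U,V)\|_{\mathcal V_e}>0$, $\|(\lambda,\chi)\|_{\mathcal W_e}>0$ and $$\frac{\mathcal A((U,V),(\lambda,\chi))}{\|(U,V)\|_{\mathcal V_e}\,\|(\lambda,\chi)\|_{\mathcal W_e}}\ \ge\ \frac{1}{2\sqrt{C_\Omega^2/c_0^2+4T^2}} .$$ -/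

import Mathlib

open MeasureTheory Set
open scoped RealInnerProductSpace ENNReal ContDiff Gradient

noncomputable section

namespace WaveInfSup

/-! ### Function spaces on the spatial domain -/

/-- The Euclidean space `ℝᵈ`. -/
abbrev Vec (d : ℕ) : Type := EuclideanSpace ℝ (Fin d)

/-- `L²(Ω)`. -/
abbrev L2 {d : ℕ} (Ω : Set (Vec d)) : Type := Lp ℝ 2 (volume.restrict Ω)

/-- `L²(Ω)ᵈ`. -/
abbrev L2Vec {d : ℕ} (Ω : Set (Vec d)) : Type := Lp (Vec d) 2 (volume.restrict Ω)

/-- `L²(Ω) × L²(Ω)ᵈ` with the Hilbert norm `(‖u‖² + ‖g‖²)^(1/2)`. On the pairs `(u, ∇u)` with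
`u ∈ H¹(Ω)` this is the `H¹(Ω)` norm. -/
abbrev PairSpace {d : ℕ} (Ω : Set (Vec d)) : Type := WithLp 2 (L2 Ω × L2Vec Ω)

/-- `φ ∈ C_c^∞(S)`. -/
def IsTestFun {E : Type*} [NormedAddCommGroup E] [NormedSpace ℝ E] (S : Set E) (φ : E → ℝ) :
    Prop :=
  ContDiff ℝ ∞ φ ∧ HasCompactSupport φ ∧ tsupport φ ⊆ S

lemma IsTestFun.add {E : Type*} [NormedAddCommGroup E] [NormedSpace ℝ E] {S : Set E}
    {φ ψ : E → ℝ} (hφ : IsTestFun S φ) (hψ : IsTestFun S ψ) : IsTestFun S (φ + ψ) :=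
  ⟨hφ.1.add hψ.1, hφ.2.1.add hψ.2.1,
    (tsupport_add φ ψ).trans (union_subset hφ.2.2 hψ.2.2)⟩

lemma IsTestFun.smul {E : Type*} [NormedAddCommGroup E] [NormedSpace ℝ E] {S : Set E}
    {φ : E → ℝ} (a : ℝ) (hφ : IsTestFun S φ) : IsTestFun S (a • φ) :=
  ⟨hφ.1.const_smul a, hφ.2.1.smul_left (f := fun _ => a),
    (tsupport_smul_subset_right (fun _ => a) φ).trans hφ.2.2⟩

lemma IsTestFun.differentiable {E : Type*} [NormedAddCommGroup E] [NormedSpace ℝ E] {S : Set E}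
    {φ : E → ℝ} (hφ : IsTestFun S φ) : Differentiable ℝ φ :=
  hφ.1.differentiable (by simp)

/-- The pairs `(φ, ∇φ)` with `φ ∈ C_c^∞(Ω)`. -/
def testGraph {d : ℕ} (Ω : Set (Vec d)) : Submodule ℝ (PairSpace Ω) where
  carrier := {p | ∃ φ : Vec d → ℝ, IsTestFun Ω φ ∧
    p.fst =ᵐ[volume.restrict Ω] φ ∧ p.snd =ᵐ[volume.restrict Ω] fun x => ∇ φ x}
  zero_mem' := by
    refine ⟨0, ⟨contDiff_const, HasCompactSupport.zero, by simp⟩, Lp.coeFn_zero _ _ _, ?_⟩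
    filter_upwards [Lp.coeFn_zero (Vec d) 2 (volume.restrict Ω)] with x hx
    simpa [gradient] using hx
  add_mem' := by
    rintro p q ⟨φ, hφ, h1, h2⟩ ⟨ψ, hψ, h3, h4⟩
    refine ⟨φ + ψ, hφ.add hψ, ?_, ?_⟩
    · filter_upwards [Lp.coeFn_add p.fst q.fst, h1, h3] with x hx h1 h3
      simpa [h1, h3] using hx
    · filter_upwards [Lp.coeFn_add p.snd q.snd, h2, h4] with x hx h2 h4
      have hg : ∇ (φ + ψ) x = ∇ φ x + ∇ ψ x := by
        simp [gradient, fderiv_add (hφ.differentiable x) (hψ.differentiable x)]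
      rw [hg, ← h2, ← h4]
      exact hx
  smul_mem' := by
    rintro a p ⟨φ, hφ, h1, h2⟩
    refine ⟨a • φ, hφ.smul a, ?_, ?_⟩
    · filter_upwards [Lp.coeFn_smul a p.fst, h1] with x hx h1
      simpa [h1] using hx
    · filter_upwards [Lp.coeFn_smul a p.snd, h2] with x hx h2
      have hg : ∇ (a • φ) x = a • ∇ φ x := by
        simp [gradient, fderiv_const_smul (hφ.differentiable x) a]
      rw [hg, ← h2]
      exact hx

/-- `H₀¹(Ω)`: the closure of `C_c^∞(Ω)` in the `H¹` norm, an element `u` being stored together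
with its weak gradient as the pair `(u, ∇u)`. -/
abbrev H10 {d : ℕ} (Ω : Set (Vec d)) : Type := (testGraph Ω).topologicalClosure

/-- The dual space `[H₀¹(Ω)]'`; the duality product `⟨f, v⟩` is `f v`. -/
abbrev H10Dual {d : ℕ} (Ω : Set (Vec d)) : Type := H10 Ω →L[ℝ] ℝ

/-- The embedding `H₀¹(Ω) → L²(Ω)`. -/
def toL2 {d : ℕ} (Ω : Set (Vec d)) : H10 Ω →L[ℝ] L2 Ω :=
  (WithLp.fstL 2 ℝ (L2 Ω) (L2Vec Ω)).comp (testGraph Ω).topologicalClosure.subtypeL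

/-- The weak gradient `∇ : H₀¹(Ω) → L²(Ω)ᵈ`. -/
def grad {d : ℕ} (Ω : Set (Vec d)) : H10 Ω →L[ℝ] L2Vec Ω :=
  (WithLp.sndL 2 ℝ (L2 Ω) (L2Vec Ω)).comp (testGraph Ω).topologicalClosure.subtypeL

/-- The embedding `L²(Ω) → [H₀¹(Ω)]'`, `⟨f, v⟩ = (f, v)_{L²(Ω)}`. -/
def toDual {d : ℕ} (Ω : Set (Vec d)) : L2 Ω →L[ℝ] H10Dual Ω :=
  (innerSL ℝ (E := L2 Ω)).bilinearComp (ContinuousLinearMap.id ℝ (L2 Ω)) (toL2 Ω)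

lemma toDual_apply {d : ℕ} (Ω : Set (Vec d)) (f : L2 Ω) (v : H10 Ω) :
    toDual Ω f v = ⟪f, toL2 Ω v⟫ := rfl

/-- `C` is a constant in the Poincaré inequality `‖v‖ ≤ C ‖∇v‖` on `H₀¹(Ω)`. -/
def IsPoincareConst {d : ℕ} (Ω : Set (Vec d)) (C : ℝ) : Prop :=
  0 < C ∧ ∀ v : H10 Ω, ‖toL2 Ω v‖ ≤ C * ‖grad Ω v‖

/-- The assumptions on the wave speed: `c ∈ L^∞(Ω)` and `c ≥ c₀ > 0` almost everywhere. -/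
structure IsWaveSpeed {d : ℕ} (Ω : Set (Vec d)) (c : Vec d → ℝ) (c₀ : ℝ) : Prop where
  pos : 0 < c₀
  memLp : MemLp c ∞ (volume.restrict Ω)
  le : ∀ᵐ x ∂(volume.restrict Ω), c₀ ≤ c x

/-- `(c² ∇u, ∇v)_{L²(Ω)}`. -/
def energy {d : ℕ} (Ω : Set (Vec d)) (c : Vec d → ℝ) (u v : H10 Ω) : ℝ :=
  ∫ x in Ω, ⟪(c x) ^ 2 • grad Ω u x, grad Ω v x⟫

/-- `‖c ∇u‖²_{L²(Ω)}`. -/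
def energyNormSq {d : ℕ} (Ω : Set (Vec d)) (c : Vec d → ℝ) (u : H10 Ω) : ℝ :=
  ∫ x in Ω, ‖c x • grad Ω u x‖ ^ 2

/-! ### The Poincaré inequality and the Newton potential -/

lemma IsTestFun.sq_integral_le {d : ℕ} (hd : 0 < d) {Ω : Set (Vec d)} {R : ℝ}
    (hΩ : ∀ x ∈ Ω, ‖x‖ ≤ R) {φ : Vec d → ℝ} (hφ : IsTestFun Ω φ) :
    ∫ x, φ x ^ 2 ≤ 4 * R ^ 2 * ∫ x, ‖∇ φ x‖ ^ 2 := by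
  obtain ⟨h1, h2, h3⟩ := hφ
  have hdiff : Differentiable ℝ φ := h1.differentiable (by simp)
  have hc : Continuous φ := h1.continuous
  have hfd : Continuous (fderiv ℝ φ) := h1.continuous_fderiv (by simp)
  have hgc : Continuous (fun x => ∇ φ x) :=
    (InnerProductSpace.toDual ℝ (Vec d)).symm.continuous.comp hfd
  have hgs : HasCompactSupport (fun x => ∇ φ x) := by
    refine (h2.fderiv (𝕜 := ℝ)).mono ?_
    intro x hx h0
    apply hx
    simp [gradient, h0]
  obtain ⟨e, he⟩ : ∃ e : Vec d, ‖e‖ = 1 := ⟨EuclideanSpace.single ⟨0, hd⟩ 1, by simp⟩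
  obtain ⟨g, hg⟩ : ∃ g : Vec d →L[ℝ] ℝ, ∀ x, g x = ⟪e, x⟫ := ⟨innerSL ℝ e, fun x => rfl⟩
  have hgd : Differentiable ℝ g := g.differentiable
  have hg' : ∀ x, fderiv ℝ g x e = 1 := by
    intro x
    rw [g.fderiv, hg, real_inner_self_eq_norm_sq, he, one_pow]
  have hgcont : Continuous g := hgd.continuous
  have hsq' : ∀ x, fderiv ℝ (fun x => φ x ^ 2) x e = 2 * φ x * fderiv ℝ φ x e := by
    intro x
    rw [((hdiff x).hasFDerivAt.pow 2).fderiv]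
    simp
  have hfe : Continuous (fun x => fderiv ℝ φ x e) := hfd.clm_apply continuous_const
  have hs2 : HasCompactSupport (fun x => φ x ^ 2) :=
    h2.mono fun x hx h0 => hx (by simp [h0])
  have hint2 : Integrable (fun x => φ x ^ 2) :=
    (hc.pow 2).integrable_of_hasCompactSupport hs2
  have hintg : Integrable (fun x => ‖∇ φ x‖ ^ 2) :=
    (hgc.norm.pow 2).integrable_of_hasCompactSupport
      (hgs.mono fun x hx h0 => hx (by have h0' : ∇ φ x = 0 := h0; simp [h0']))
  have hint1 : Integrable (fun x => fderiv ℝ (fun x => φ x ^ 2) x e * g x) := by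
    simp_rw [hsq']
    have hcont : Continuous (fun x => 2 * φ x * fderiv ℝ φ x e * g x) :=
      ((continuous_const.mul hc).mul hfe).mul hgcont
    exact hcont.integrable_of_hasCompactSupport
      (h2.mono fun x hx h0 => hx (by simp [h0]))
  have hint3 : Integrable (fun x => φ x ^ 2 * g x) :=
    ((hc.pow 2).mul hgcont).integrable_of_hasCompactSupport
      (h2.mono fun x hx h0 => hx (by simp [h0]))
  have hint4 : Integrable (fun x => φ x ^ 2 * fderiv ℝ g x e) := by
    simp_rw [hg', mul_one]
    exact hint2
  have key := integral_mul_fderiv_eq_neg_fderiv_mul_of_integrable (μ := (volume : Measure (Vec d)))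
    (f := fun x => φ x ^ 2) (g := g) (v := e) hint1 hint4 hint3
    (fun x _ => (hdiff x).pow 2) (fun x _ => hgd x)
  simp only [hg', mul_one] at key
  have hle : ∫ x, φ x ^ 2 ≤ ∫ x, (φ x ^ 2 / 2 + 2 * R ^ 2 * ‖∇ φ x‖ ^ 2) := by
    rw [key, ← integral_neg]
    refine integral_mono hint1.neg ((hint2.div_const 2).add (hintg.const_mul _)) fun x => ?_
    simp only [hsq']
    by_cases hx : φ x = 0
    · simp only [hx]
      norm_num
      positivity
    · have hxΩ : ‖x‖ ≤ R := hΩ x (h3 (subset_tsupport _ hx))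
      have hgx : |g x| ≤ R := by
        calc |g x| ≤ ‖e‖ * ‖x‖ := by rw [hg]; exact abs_real_inner_le_norm e x
          _ ≤ R := by rw [he, one_mul]; exact hxΩ
      have hdx : |fderiv ℝ φ x e| ≤ ‖∇ φ x‖ := by
        rw [← inner_gradient_left]
        calc |⟪∇ φ x, e⟫| ≤ ‖∇ φ x‖ * ‖e‖ := abs_real_inner_le_norm _ _
          _ = ‖∇ φ x‖ := by rw [he, mul_one]
      have hprod : |fderiv ℝ φ x e * g x| ≤ ‖∇ φ x‖ * R := by
        rw [abs_mul]
        exact mul_le_mul hdx hgx (abs_nonneg _) (norm_nonneg _)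
      have h5 : -(2 * φ x * fderiv ℝ φ x e * g x) ≤ 2 * (|φ x| * (‖∇ φ x‖ * R)) := by
        have := neg_abs_le (φ x * (fderiv ℝ φ x e * g x))
        rw [abs_mul] at this
        have h6 := mul_le_mul_of_nonneg_left hprod (abs_nonneg (φ x))
        nlinarith
      nlinarith [sq_nonneg (|φ x| - 2 * (‖∇ φ x‖ * R)), sq_abs (φ x)]
  rw [integral_add (hint2.div_const 2) (hintg.const_mul _), integral_div, integral_const_mul]
    at hle
  linarith

/-- The Poincaré inequality on bounded sets. -/
theorem exists_isPoincareConst {d : ℕ} (hd : 0 < d) {Ω : Set (Vec d)}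
    (hΩ : Bornology.IsBounded Ω) : ∃ C, IsPoincareConst Ω C := by
  obtain ⟨R, hR0, hR⟩ := hΩ.exists_pos_norm_le
  refine ⟨2 * R, by positivity, fun v => ?_⟩
  have hcl : IsClosed {p : PairSpace Ω | ‖p.fst‖ ≤ 2 * R * ‖p.snd‖} :=
    isClosed_le (WithLp.fstL 2 ℝ (L2 Ω) (L2Vec Ω)).continuous.norm
      (continuous_const.mul (WithLp.sndL 2 ℝ (L2 Ω) (L2Vec Ω)).continuous.norm)
  have hsub : (testGraph Ω : Set (PairSpace Ω)) ⊆ {p | ‖p.fst‖ ≤ 2 * R * ‖p.snd‖} := by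
    rintro p ⟨φ, hφ, h1, h2⟩
    have hmain := hφ.sq_integral_le hd hR
    have e1 : ‖p.fst‖ ^ 2 = ∫ x, φ x ^ 2 := by
      rw [← real_inner_self_eq_norm_sq, L2.inner_def,
        ← setIntegral_eq_integral_of_forall_compl_eq_zero (s := Ω) (f := fun x => φ x ^ 2)]
      · refine integral_congr_ae ?_
        filter_upwards [h1] with x hx
        rw [hx, real_inner_self_eq_norm_sq, Real.norm_eq_abs, sq_abs]
      · intro x hx
        have : φ x = 0 := by
          by_contra h
          exact hx (hφ.2.2 (subset_tsupport _ h))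
        simp [this]
    have e2 : ‖p.snd‖ ^ 2 = ∫ x, ‖∇ φ x‖ ^ 2 := by
      rw [← real_inner_self_eq_norm_sq, L2.inner_def,
        ← setIntegral_eq_integral_of_forall_compl_eq_zero (s := Ω)
          (f := fun x => ‖∇ φ x‖ ^ 2)]
      · refine integral_congr_ae ?_
        filter_upwards [h2] with x hx
        rw [hx, real_inner_self_eq_norm_sq]
      · intro x hx
        have hx' : fderiv ℝ φ x = 0 := by
          by_contra h
          exact hx (hφ.2.2 (support_fderiv_subset ℝ h))
        simp [gradient, hx']
    rw [← e1, ← e2] at hmain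
    refine (sq_le_sq₀ (norm_nonneg _) (by positivity)).1 ?_
    calc ‖p.fst‖ ^ 2 ≤ _ := hmain
      _ = _ := by ring
  exact closure_minimal hsub hcl v.2

/-- Multiplication by `c ∈ L^∞(Ω)` on `L²(Ω)ᵈ`. -/
def mulCoeff {d : ℕ} {Ω : Set (Vec d)} {c : Vec d → ℝ}
    (hc : MemLp c ∞ (volume.restrict Ω)) : L2Vec Ω →L[ℝ] L2Vec Ω :=
  (ContinuousLinearMap.lsmul ℝ ℝ).holderL (volume.restrict Ω) ∞ 2 2 (hc.toLp c)

lemma mulCoeff_ae {d : ℕ} {Ω : Set (Vec d)} {c : Vec d → ℝ}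
    (hc : MemLp c ∞ (volume.restrict Ω)) (g : L2Vec Ω) :
    mulCoeff hc g =ᵐ[volume.restrict Ω] fun x => c x • g x := by
  filter_upwards [ContinuousLinearMap.coeFn_holder (r := 2) (ContinuousLinearMap.lsmul ℝ ℝ)
    (hc.toLp c) g, hc.coeFn_toLp] with x hx h2
  change (ContinuousLinearMap.holder 2 _ _ g : Vec d → Vec d) x = _
  rw [hx, h2]
  rfl

/-- The bounded bilinear form `(c² ∇u, ∇v)_{L²(Ω)}` on `H₀¹(Ω)`. -/
def energyForm {d : ℕ} {Ω : Set (Vec d)} {c : Vec d → ℝ}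
    (hc : MemLp c ∞ (volume.restrict Ω)) : H10 Ω →L[ℝ] H10 Ω →L[ℝ] ℝ :=
  (innerSL ℝ (E := L2Vec Ω)).bilinearComp ((mulCoeff hc).comp (grad Ω))
    ((mulCoeff hc).comp (grad Ω))

lemma energyForm_apply {d : ℕ} {Ω : Set (Vec d)} {c : Vec d → ℝ}
    (hc : MemLp c ∞ (volume.restrict Ω)) (u v : H10 Ω) :
    energyForm hc u v = energy Ω c u v := by
  change ⟪mulCoeff hc (grad Ω u), mulCoeff hc (grad Ω v)⟫ = _
  rw [L2.inner_def]
  refine integral_congr_ae ?_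
  filter_upwards [mulCoeff_ae hc (grad Ω u), mulCoeff_ae hc (grad Ω v)] with x h1 h2
  rw [h1, h2, real_inner_smul_left, real_inner_smul_left, real_inner_smul_right]
  ring

lemma energyForm_coercive {d : ℕ} (hd : 0 < d) {Ω : Set (Vec d)} (hΩ : Bornology.IsBounded Ω)
    {c : Vec d → ℝ} {c₀ : ℝ} (hc : IsWaveSpeed Ω c c₀) : IsCoercive (energyForm hc.memLp) := by
  obtain ⟨C, hC0, hC⟩ := exists_isPoincareConst hd hΩ
  have h0 := hc.pos
  refine ⟨c₀ ^ 2 / (C ^ 2 + 1), by positivity, fun u => ?_⟩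
  have h1 : c₀ * ‖grad Ω u‖ ≤ ‖mulCoeff hc.memLp (grad Ω u)‖ := by
    have : ‖c₀ • grad Ω u‖ ≤ ‖mulCoeff hc.memLp (grad Ω u)‖ := by
      refine Lp.norm_le_norm_of_ae_le ?_
      filter_upwards [mulCoeff_ae hc.memLp (grad Ω u), Lp.coeFn_smul c₀ (grad Ω u), hc.le]
        with x h2 h3 h4
      rw [h2, h3, Pi.smul_apply, norm_smul, norm_smul, Real.norm_of_nonneg h0.le,
        Real.norm_of_nonneg (h0.le.trans h4)]
      exact mul_le_mul_of_nonneg_right h4 (norm_nonneg _)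
    rwa [norm_smul, Real.norm_of_nonneg h0.le] at this
  have h2 : energyForm hc.memLp u u = ‖mulCoeff hc.memLp (grad Ω u)‖ ^ 2 :=
    real_inner_self_eq_norm_sq (mulCoeff hc.memLp (grad Ω u))
  have h3 : ‖u‖ ^ 2 = ‖toL2 Ω u‖ ^ 2 + ‖grad Ω u‖ ^ 2 :=
    WithLp.prod_norm_sq_eq_of_L2 (u : PairSpace Ω)
  have h4 : ‖u‖ ^ 2 ≤ (C ^ 2 + 1) * ‖grad Ω u‖ ^ 2 := by
    have := pow_le_pow_left₀ (norm_nonneg _) (hC u) 2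
    rw [h3]
    nlinarith
  rw [h2]
  calc c₀ ^ 2 / (C ^ 2 + 1) * ‖u‖ * ‖u‖ = c₀ ^ 2 / (C ^ 2 + 1) * ‖u‖ ^ 2 := by ring
    _ ≤ c₀ ^ 2 / (C ^ 2 + 1) * ((C ^ 2 + 1) * ‖grad Ω u‖ ^ 2) := by gcongr
    _ = (c₀ * ‖grad Ω u‖) ^ 2 := by field_simp
    _ ≤ _ := by gcongr

/-- The Riesz isomorphism `[H₀¹(Ω)]' → H₀¹(Ω)`. -/
def riesz {d : ℕ} (Ω : Set (Vec d)) : H10Dual Ω →L[ℝ] H10 Ω where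
  toFun f := (InnerProductSpace.toDual ℝ (H10 Ω)).symm f
  map_add' f g := map_add _ f g
  map_smul' a f := by simp
  cont := (InnerProductSpace.toDual ℝ (H10 Ω)).symm.continuous

lemma inner_riesz {d : ℕ} (Ω : Set (Vec d)) (f : H10Dual Ω) (v : H10 Ω) : ⟪riesz Ω f, v⟫ = f v :=
  InnerProductSpace.toDual_symm_apply

/-- The Newton potential `N : [H₀¹(Ω)]' → H₀¹(Ω)`, i.e. the operator with
`(c² ∇(N f), ∇v)_{L²(Ω)} = ⟨f, v⟩` for all `v ∈ H₀¹(Ω)`; see `energy_newton`. -/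
def newton {d : ℕ} (hd : 0 < d) {Ω : Set (Vec d)} (hΩ : Bornology.IsBounded Ω)
    {c : Vec d → ℝ} {c₀ : ℝ} (hc : IsWaveSpeed Ω c c₀) : H10Dual Ω →L[ℝ] H10 Ω :=
  ((energyForm_coercive hd hΩ hc).continuousLinearEquivOfBilin.symm :
      H10 Ω →L[ℝ] H10 Ω).comp
    (riesz Ω)

theorem energy_newton {d : ℕ} (hd : 0 < d) {Ω : Set (Vec d)} (hΩ : Bornology.IsBounded Ω)
    {c : Vec d → ℝ} {c₀ : ℝ} (hc : IsWaveSpeed Ω c c₀) (f : H10Dual Ω) (v : H10 Ω) :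
    energy Ω c (newton hd hΩ hc f) v = f v := by
  rw [← energyForm_apply hc.memLp,
    ← (energyForm_coercive hd hΩ hc).continuousLinearEquivOfBilin_apply]
  rw [← inner_riesz Ω f v]
  congr 1
  exact (energyForm_coercive hd hΩ hc).continuousLinearEquivOfBilin.apply_symm_apply _

/-- `‖f‖²_N = ⟨f, N f⟩` on `[H₀¹(Ω)]'`. -/
def newtonNormSq {d : ℕ} (hd : 0 < d) {Ω : Set (Vec d)} (hΩ : Bornology.IsBounded Ω)
    {c : Vec d → ℝ} {c₀ : ℝ} (hc : IsWaveSpeed Ω c c₀) (f : H10Dual Ω) : ℝ :=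
  f (newton hd hΩ hc f)

/-! ### Functions of time with values in a Banach space -/

/-- The Bochner space `L²(0,T;X)`. -/
abbrev TimeL2 (T : ℝ) (X : Type) [NormedAddCommGroup X] : Type :=
  Lp X 2 (volume.restrict (Ioo (0 : ℝ) T))

/-- `u' ∈ L²(0,T;X)` is the weak time derivative of `u ∈ L²(0,T;X)`. -/
def HasWeakTimeDeriv {T : ℝ} {X : Type} [NormedAddCommGroup X] [NormedSpace ℝ X]
    (u u' : TimeL2 T X) : Prop :=
  ∀ φ : ℝ → ℝ, IsTestFun (Ioo 0 T) φ →
    ∫ s in Ioo 0 T, deriv φ s • u s = -∫ s in Ioo 0 T, φ s • u' s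

open Classical in
/-- The weak time derivative `∂ₜu` of `u ∈ H¹(0,T;X)` (and `0` if `u ∉ H¹(0,T;X)`). -/
def timeDeriv {T : ℝ} {X : Type} [NormedAddCommGroup X] [NormedSpace ℝ X]
    (u : TimeL2 T X) : TimeL2 T X :=
  if h : ∃ u', HasWeakTimeDeriv u u' then h.choose else 0

/-- `u ∈ H¹_{0,•}(0,T;X)`: `u ∈ L²(0,T;X)` has a weak derivative in `L²(0,T;X)`, and its
representative that is continuous on `[0,T]` vanishes at `0`. -/
def MemH1Zero {T : ℝ} {X : Type} [NormedAddCommGroup X] [NormedSpace ℝ X]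
    (u : TimeL2 T X) : Prop :=
  (∃ u', HasWeakTimeDeriv u u') ∧
    ∃ w : ℝ → X, ContinuousOn w (Icc 0 T) ∧ u =ᵐ[volume.restrict (Ioo 0 T)] w ∧ w 0 = 0

/-- For `u ∈ L²(0,T;X)` and a bounded operator `L : X → Y`, the function `s ↦ L (u s)` in
`L²(0,T;Y)`. -/
def timeMap {T : ℝ} {X Y : Type} [NormedAddCommGroup X] [NormedSpace ℝ X]
    [NormedAddCommGroup Y] [NormedSpace ℝ Y] (L : X →L[ℝ] Y) (u : TimeL2 T X) : TimeL2 T Y :=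
  L.compLp u

/-- `∫₀ᵀ f(s) e^{-s/T} ds`. -/
def weightedInt (T : ℝ) (f : ℝ → ℝ) : ℝ :=
  ∫ s in Ioo 0 T, f s * Real.exp (-s / T)

/-! ### The bilinear form and the norms

In the following `U : L²(0,T;H₀¹(Ω))` is also regarded as an element of `L²(Q_T) = L²(0,T;L²(Ω))`
through `toL2`, and elements of `L²(0,T;L²(Ω))` as elements of `L²(0,T;[H₀¹(Ω)]')` through
`toDual`. Thus `∂ₜU` is taken in `L²(Q_T)` and `∂ₜV` in `L²(0,T;[H₀¹(Ω)]')`, as for functions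
`U ∈ L²(0,T;H₀¹(Ω)) ∩ H¹(0,T;L²(Ω))` and `V ∈ L²(Q_T) ∩ H¹(0,T;[H₀¹(Ω)]')`. -/

/-- The bilinear form
`A((U,V),(λ,χ)) = ⟨∂ₜV, λ⟩ₑ + (c²∇U, ∇λ)ₑ - (∂ₜU, χ)ₑ + (V, χ)ₑ`. -/
def bilinA {d : ℕ} {Ω : Set (Vec d)} {T : ℝ} (c : Vec d → ℝ)
    (U : TimeL2 T (H10 Ω)) (V : TimeL2 T (L2 Ω))
    (lam : TimeL2 T (H10 Ω)) (chi : TimeL2 T (L2 Ω)) : ℝ :=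
  weightedInt T (fun s => (timeDeriv (timeMap (Y := H10Dual Ω) (toDual Ω) V) s) (lam s))
    + weightedInt T (fun s => energy Ω c (U s) (lam s))
    - weightedInt T (fun s => ⟪timeDeriv (timeMap (toL2 Ω) U) s, chi s⟫)
    + weightedInt T (fun s => ⟪V s, chi s⟫)

/-- `‖(U,V)‖_{V_e} = (‖∂ₜU‖²ₑ + ‖∂ₜV‖²_{N,e} + ‖c∇U‖²ₑ + ‖V‖²ₑ)^(1/2)`. -/
def normV {d : ℕ} (hd : 0 < d) {Ω : Set (Vec d)} (hΩ : Bornology.IsBounded Ω)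
    {c : Vec d → ℝ} {c₀ : ℝ} (hc : IsWaveSpeed Ω c c₀) {T : ℝ}
    (U : TimeL2 T (H10 Ω)) (V : TimeL2 T (L2 Ω)) : ℝ :=
  Real.sqrt
    (weightedInt T (fun s => ‖timeDeriv (timeMap (toL2 Ω) U) s‖ ^ 2)
      + weightedInt T (fun s => newtonNormSq hd hΩ hc (timeDeriv (timeMap (Y := H10Dual Ω) (toDual Ω) V) s))
      + weightedInt T (fun s => energyNormSq Ω c (U s))
      + weightedInt T (fun s => ‖V s‖ ^ 2))

/-- `‖(λ,χ)‖_{W_e} = (‖λ‖²ₑ + ‖χ‖²_{N,e})^(1/2)`. -/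
def normW {d : ℕ} (hd : 0 < d) {Ω : Set (Vec d)} (hΩ : Bornology.IsBounded Ω)
    {c : Vec d → ℝ} {c₀ : ℝ} (hc : IsWaveSpeed Ω c c₀) {T : ℝ}
    (lam : TimeL2 T (H10 Ω)) (chi : TimeL2 T (L2 Ω)) : ℝ :=
  Real.sqrt
    (weightedInt T (fun s => ‖toL2 Ω (lam s)‖ ^ 2)
      + weightedInt T (fun s => newtonNormSq hd hΩ hc (toDual Ω (chi s))))

end WaveInfSup

end

/-!
Write `p = ∂ₜU` and `q = ∂ₜV` in `L²(Q_T)`, `n = N q`, and `L = c ∇`. The Newton potential turns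
every duality product into an inner product: `⟨q, v⟩ = (L n, L v)` for `v ∈ H₀¹(Ω)`, so that
`‖q‖_N = ‖L n‖`. Below, inner products and norms are those of `L²` with weight `e^{-t/T}` in time
(`weightedInner`).

With `χ = -p + 2T q` and `λ = n + 2T p`, the terms `2T (q, p)` and `-2T (p, q)` of `A` cancel, and
`A = ‖L n‖² + ‖p‖² + (L U, L n) - (V, p) + 2T (L U, L ∂ₜU) + 2T (V, q)`.
Functions in `H¹_{0,•}` are primitives of their weak derivatives
(`MemH1Zero.ae_eq_primitive`), so integrating the derivative of `‖u‖² e^{-t/T}` gives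
`2T (u, ∂ₜu) ≥ ‖u‖²` (`MemH1Zero.weightedInner_self_le`). Applied to `L U` and `V`, this leaves
`A - ‖(U,V)‖² / 2 ≥ (‖L n + L U‖² + ‖p - V‖²) / 2 ≥ 0` (`half_le_of_energy`).

In the square of the test norm the cross terms `4T (N q, p)` and `-4T (p, q)_N` are opposite
(`weightedInner_test_add`), so it equals `‖N q‖² + 4T² ‖p‖² + ‖p‖_N² + 4T² ‖q‖_N²`. The Poincaré
inequality gives `‖N q‖ ≤ (C / c₀) ‖q‖_N` and, by duality, `‖p‖_N ≤ (C / c₀) ‖p‖`; hence it is at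
most `(C² / c₀² + 4T²) (‖p‖² + ‖q‖_N²) ≤ (C² / c₀² + 4T²) ‖(U,V)‖²`. The quotient bound follows.

Both norms are positive as soon as `‖p‖² + ‖q‖_N² > 0` (`weightedInner_derivatives_pos`). If that
sum vanished, then `∂ₜU` and `∂ₜV` would vanish, because `H₀¹(Ω) → L²(Ω) → [H₀¹(Ω)]'` are injective
(`toL2_injective`, `toDual_injective`), and `U = V = 0` by the initial conditions.
-/

noncomputable section

namespace WaveInfSup

/-! ### Absolutely continuous functions with values in a Banach space -/

lemma absolutelyContinuousOnInterval_of_dist_le {X Y : Type*} [PseudoMetricSpace X]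
    [PseudoMetricSpace Y] {f : ℝ → X} {g : ℝ → Y} {a b : ℝ}
    (hg : AbsolutelyContinuousOnInterval g a b)
    (h : ∀ x ∈ uIcc a b, ∀ y ∈ uIcc a b, dist (f x) (f y) ≤ dist (g x) (g y)) :
    AbsolutelyContinuousOnInterval f a b := by
  rw [absolutelyContinuousOnInterval_iff] at hg ⊢
  intro ε hε
  obtain ⟨δ, hδ, H⟩ := hg ε hε
  refine ⟨δ, hδ, fun E hE hlt => (Finset.sum_le_sum fun i hi => ?_).trans_lt (H E hE hlt)⟩
  exact h _ (hE.1 i hi).1 _ (hE.1 i hi).2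

lemma _root_.IntervalIntegrable.absolutelyContinuousOnInterval_primitive {X : Type*}
    [NormedAddCommGroup X] [NormedSpace ℝ X] {f : ℝ → X} {a b : ℝ}
    (hf : IntervalIntegrable f volume a b) :
    AbsolutelyContinuousOnInterval (fun x => ∫ t in a..x, f t) a b := by
  refine absolutelyContinuousOnInterval_of_dist_le
    (hf.norm.absolutelyContinuousOnInterval_intervalIntegral (c := a) left_mem_uIcc)
    fun x hx y hy => ?_
  have hax : IntervalIntegrable f volume a x :=
    hf.mono_set (uIcc_subset_uIcc left_mem_uIcc hx)
  have hay : IntervalIntegrable f volume a y :=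
    hf.mono_set (uIcc_subset_uIcc left_mem_uIcc hy)
  rw [dist_eq_norm, Real.dist_eq, intervalIntegral.integral_interval_sub_left hax hay,
    intervalIntegral.integral_interval_sub_left hax.norm hay.norm]
  exact intervalIntegral.norm_integral_le_abs_integral_norm

/-- The fundamental theorem of calculus for absolutely continuous functions with values in a
Banach space. Differentiability almost everywhere is a hypothesis, since it does not follow from
absolute continuity without the Radon–Nikodym property. -/
lemma integral_eq_sub_of_ae_hasDerivAt {X : Type*} [NormedAddCommGroup X] [NormedSpace ℝ X]
    [CompleteSpace X] {f f' : ℝ → X} {a b : ℝ} (hf : AbsolutelyContinuousOnInterval f a b)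
    (hd : ∀ᵐ x, x ∈ uIcc a b → HasDerivAt f (f' x) x)
    (hi : IntervalIntegrable f' volume a b) : ∫ x in a..b, f' x = f b - f a := by
  obtain ⟨K, hK⟩ := (hf.sub hi.absolutelyContinuousOnInterval_primitive).const_of_ae_hasDerivAt_zero
    (by
      filter_upwards [hd, hi.ae_hasDerivAt_integral] with x h1 h2 hx
      simpa using (h1 hx).sub (h2 hx a left_mem_uIcc))
  have ha := hK a left_mem_uIcc
  have hb := hK b right_mem_uIcc
  simp only [Pi.sub_apply, intervalIntegral.integral_same, sub_zero] at ha hb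
  rw [ha, ← hb]
  abel

/-! ### Weak derivatives in time -/

lemma integrable_timeL2 {T : ℝ} {X : Type} [NormedAddCommGroup X] (u : TimeL2 T X) :
    IntegrableOn u (Ioo 0 T) :=
  (Lp.memLp u).integrable one_le_two

lemma intervalIntegrable_timeL2 {T : ℝ} (hT : 0 < T) {X : Type} [NormedAddCommGroup X]
    (u : TimeL2 T X) : IntervalIntegrable u volume 0 T :=
  (intervalIntegrable_iff_integrableOn_Ioo_of_le hT.le).2 (integrable_timeL2 u)

lemma setIntegral_Ioo_eq_interval {T : ℝ} (hT : 0 < T) {X : Type*} [NormedAddCommGroup X]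
    [NormedSpace ℝ X] (f : ℝ → X) : ∫ s in Ioo 0 T, f s = ∫ s in 0..T, f s := by
  rw [intervalIntegral.integral_of_le hT.le, integral_Ioc_eq_integral_Ioo]

lemma IsTestFun.integrableOn_smul {S : Set ℝ} {φ : ℝ → ℝ} (hφ : IsTestFun S φ) {X : Type*}
    [NormedAddCommGroup X] [NormedSpace ℝ X] {s : Set ℝ} {f : ℝ → X}
    (hf : IntegrableOn f s) : IntegrableOn (fun t => φ t • f t) s := by
  obtain ⟨K, hK⟩ := hφ.2.1.exists_bound_of_continuous hφ.1.continuous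
  exact Integrable.bdd_smul hf K hφ.1.continuous.aestronglyMeasurable (.of_forall hK)

lemma IsTestFun.isTestFun_deriv {S : Set ℝ} {φ : ℝ → ℝ} (hφ : IsTestFun S φ) : IsTestFun S (deriv φ) :=
  ⟨(contDiff_infty_iff_deriv.1 hφ.1).2, hφ.2.1.deriv, (tsupport_deriv_subset).trans hφ.2.2⟩

lemma IsTestFun.eq_zero_of_notMem {E : Type*} [NormedAddCommGroup E] [NormedSpace ℝ E] {S : Set E}
    {φ : E → ℝ} (hφ : IsTestFun S φ) {x : E} (hx : x ∉ S) : φ x = 0 :=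
  image_eq_zero_of_notMem_tsupport fun h => hx (hφ.2.2 h)

lemma ae_eq_zero_of_integral_testFun {E : Type*} [NormedAddCommGroup E] [NormedSpace ℝ E]
    [FiniteDimensional ℝ E] [MeasurableSpace E] [BorelSpace E] {μ : Measure E} {S : Set E}
    (hS : IsOpen S) {X : Type*} [NormedAddCommGroup X] [NormedSpace ℝ X]
    [CompleteSpace X] {f : E → X} (hf : IntegrableOn f S μ)
    (h : ∀ φ : E → ℝ, IsTestFun S φ → ∫ s in S, φ s • f s ∂μ = 0) :
    f =ᵐ[μ.restrict S] 0 := by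
  refine (ae_restrict_iff' hS.measurableSet).2 ?_
  refine hS.ae_eq_zero_of_integral_contDiff_smul_eq_zero hf.locallyIntegrableOn ?_
  intro g h1 h2 h3
  rw [← h g ⟨h1, h2, h3⟩]
  refine (setIntegral_eq_integral_of_forall_compl_eq_zero fun x hx => ?_).symm
  rw [IsTestFun.eq_zero_of_notMem ⟨h1, h2, h3⟩ hx, zero_smul]

lemma HasWeakTimeDeriv.unique {T : ℝ} {X : Type} [NormedAddCommGroup X] [NormedSpace ℝ X]
    [CompleteSpace X] {u u₁ u₂ : TimeL2 T X} (h₁ : HasWeakTimeDeriv u u₁)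
    (h₂ : HasWeakTimeDeriv u u₂) : u₁ = u₂ := by
  refine Lp.ext ?_
  have h : (fun s => u₁ s - u₂ s) =ᵐ[volume.restrict (Ioo 0 T)] 0 := by
    refine ae_eq_zero_of_integral_testFun isOpen_Ioo ((integrable_timeL2 u₁).sub (integrable_timeL2 u₂)) ?_
    intro φ hφ
    simp only [smul_sub]
    rw [integral_sub (hφ.integrableOn_smul (integrable_timeL2 u₁))
      (hφ.integrableOn_smul (integrable_timeL2 u₂)), sub_eq_zero]
    exact neg_injective ((h₁ φ hφ).symm.trans (h₂ φ hφ))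
  filter_upwards [h] with s hs
  exact sub_eq_zero.1 hs

lemma MemH1Zero.hasWeakTimeDeriv {T : ℝ} {X : Type} [NormedAddCommGroup X] [NormedSpace ℝ X]
    {u : TimeL2 T X} (h : MemH1Zero u) : HasWeakTimeDeriv u (timeDeriv u) := by
  rw [timeDeriv, dif_pos h.1]
  exact h.1.choose_spec

lemma timeMap_ae {T : ℝ} {X Y : Type} [NormedAddCommGroup X] [NormedSpace ℝ X]
    [NormedAddCommGroup Y] [NormedSpace ℝ Y] (L : X →L[ℝ] Y) (u : TimeL2 T X) :
    timeMap L u =ᵐ[volume.restrict (Ioo 0 T)] fun s => L (u s) :=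
  L.coeFn_compLp u

lemma HasWeakTimeDeriv.comp_timeMap {T : ℝ} {X Y : Type} [NormedAddCommGroup X] [NormedSpace ℝ X]
    [CompleteSpace X] [NormedAddCommGroup Y] [NormedSpace ℝ Y] [CompleteSpace Y]
    {u u' : TimeL2 T X} (h : HasWeakTimeDeriv u u') (L : X →L[ℝ] Y) :
    HasWeakTimeDeriv (timeMap L u) (timeMap L u') := by
  have key : ∀ (v : TimeL2 T X) (φ : ℝ → ℝ), IsTestFun (Ioo 0 T) φ →
      ∫ s in Ioo 0 T, φ s • timeMap L v s = L (∫ s in Ioo 0 T, φ s • v s) := by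
    intro v φ hφ
    rw [← L.integral_comp_comm (hφ.integrableOn_smul (integrable_timeL2 v))]
    refine integral_congr_ae ?_
    filter_upwards [timeMap_ae L v] with s hs
    rw [hs, map_smul]
  intro φ hφ
  rw [key u _ hφ.isTestFun_deriv, key u' φ hφ, h φ hφ, map_neg]

/-- A bounded operator commutes with the weak time derivative. -/
lemma MemH1Zero.timeDeriv_timeMap {T : ℝ} {X Y : Type} [NormedAddCommGroup X] [NormedSpace ℝ X]
    [CompleteSpace X] [NormedAddCommGroup Y] [NormedSpace ℝ Y] [CompleteSpace Y]
    {u : TimeL2 T X} (h : MemH1Zero u) (L : X →L[ℝ] Y) :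
    timeDeriv (timeMap L u) = timeMap L (timeDeriv u) := by
  have h1 := h.hasWeakTimeDeriv.comp_timeMap L
  have h2 : ∃ v, HasWeakTimeDeriv (timeMap L u) v := ⟨_, h1⟩
  refine HasWeakTimeDeriv.unique ?_ h1
  rw [timeDeriv, dif_pos h2]
  exact h2.choose_spec

/-- A test function on an interval is the derivative of a test function if and only if its integral
vanishes; this is the direction that produces the primitive. -/
lemma IsTestFun.exists_deriv_eq {T : ℝ} {θ : ℝ → ℝ} (hθ : IsTestFun (Ioo 0 T) θ)
    (h0 : ∫ s in 0..T, θ s = 0) : ∃ φ, IsTestFun (Ioo 0 T) φ ∧ deriv φ = θ := by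
  have hc := hθ.1.continuous
  have hi : ∀ a b, IntervalIntegrable θ volume a b := fun a b => hc.intervalIntegrable a b
  have hd : ∀ t, HasDerivAt (fun t => ∫ s in 0..t, θ s) (θ t) t := fun t =>
    intervalIntegral.integral_hasDerivAt_right (hi _ _) (hc.stronglyMeasurableAtFilter _ _)
      hc.continuousAt
  have hd' : deriv (fun t => ∫ s in 0..t, θ s) = θ := funext fun t => (hd t).deriv
  obtain ⟨a, ha0, ha⟩ : ∃ a, 0 < a ∧ tsupport θ ⊆ Ici a := by
    rcases (tsupport θ).eq_empty_or_nonempty with h | h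
    · exact ⟨1, one_pos, by simp [h]⟩
    · obtain ⟨a, ha, hmin⟩ := hθ.2.1.isCompact.exists_isLeast h
      exact ⟨a, (hθ.2.2 ha).1, hmin⟩
  obtain ⟨b, hb0, hb⟩ : ∃ b, b < T ∧ tsupport θ ⊆ Iic b := by
    rcases (tsupport θ).eq_empty_or_nonempty with h | h
    · exact ⟨T - 1, by linarith, by simp [h]⟩
    · obtain ⟨b, hb, hmax⟩ := hθ.2.1.isCompact.exists_isGreatest h
      exact ⟨b, (hθ.2.2 hb).2, hmax⟩
  have hsupp : Function.support (fun t => ∫ s in 0..t, θ s) ⊆ Icc a b := by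
    intro t ht
    by_contra hn
    apply ht
    rcases lt_or_ge t a with hta | hta
    · -- left of the support, the integrand vanishes between `0` and `t`
      refine intervalIntegral.integral_zero_ae (.of_forall fun s hs => ?_)
      refine image_eq_zero_of_notMem_tsupport fun h => ?_
      have h1 : a ≤ s := ha h
      have h2 : s ≤ max 0 t := hs.2
      exact absurd (h1.trans h2) (not_le.2 (max_lt ha0 hta))
    · have htb : b < t := not_le.1 fun h => hn ⟨hta, h⟩
      change ∫ s in 0..t, θ s = 0
      rw [← intervalIntegral.integral_add_adjacent_intervals (hi 0 T) (hi T t), h0, zero_add]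
      refine intervalIntegral.integral_zero_ae (.of_forall fun s hs => ?_)
      refine image_eq_zero_of_notMem_tsupport fun h => ?_
      have h1 : s ≤ b := hb h
      have h2 : min T t < s := hs.1
      exact absurd (h2.trans_le h1) (not_lt.2 (lt_min hb0 htb).le)
  have hts : tsupport (fun t => ∫ s in 0..t, θ s) ⊆ Icc a b :=
    closure_minimal hsupp isClosed_Icc
  refine ⟨fun t => ∫ s in 0..t, θ s, ⟨?_, ?_, ?_⟩, hd'⟩
  · refine contDiff_infty_iff_deriv.2 ⟨fun t => (hd t).differentiableAt, ?_⟩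
    rw [hd']
    exact hθ.1
  · exact isCompact_Icc.of_isClosed_subset (isClosed_tsupport _) hts
  · exact hts.trans fun t ht => ⟨ha0.trans_le ht.1, ht.2.trans_lt hb0⟩

lemma exists_testFun_integral_eq_one {T : ℝ} (hT : 0 < T) :
    ∃ ψ, IsTestFun (Ioo 0 T) ψ ∧ ∫ s in Ioo 0 T, ψ s = 1 := by
  let f : ContDiffBump (T / 2) := ⟨T / 8, T / 4, by positivity, by linarith⟩
  have h : IsTestFun (Ioo 0 T) (f.normed volume) := by
    refine ⟨f.contDiff_normed, f.hasCompactSupport_normed, ?_⟩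
    rw [f.tsupport_normed_eq, Real.closedBall_eq_Icc]
    intro x hx
    have h1 : T / 2 - T / 4 ≤ x := hx.1
    have h2 : x ≤ T / 2 + T / 4 := hx.2
    constructor <;> linarith
  refine ⟨_, h, ?_⟩
  rw [setIntegral_eq_integral_of_forall_compl_eq_zero fun x hx => h.eq_zero_of_notMem hx]
  exact f.integral_normed

/-- The du Bois-Reymond lemma. -/
lemma ae_eq_const_of_integral_deriv_testFun {T : ℝ} (hT : 0 < T) {X : Type*}
    [NormedAddCommGroup X] [NormedSpace ℝ X] [CompleteSpace X] {f : ℝ → X}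
    (hf : IntegrableOn f (Ioo 0 T))
    (h : ∀ φ : ℝ → ℝ, IsTestFun (Ioo 0 T) φ → ∫ s in Ioo 0 T, deriv φ s • f s = 0) :
    ∃ K : X, f =ᵐ[volume.restrict (Ioo 0 T)] fun _ => K := by
  obtain ⟨ψ₀, hψ₀, h1⟩ := exists_testFun_integral_eq_one hT
  refine ⟨∫ s in Ioo 0 T, ψ₀ s • f s, ?_⟩
  have hK : IntegrableOn (fun _ : ℝ => ∫ s in Ioo 0 T, ψ₀ s • f s) (Ioo 0 T) :=
    integrableOn_const (by simp)
  have hz : (fun s => f s - ∫ s in Ioo 0 T, ψ₀ s • f s) =ᵐ[volume.restrict (Ioo 0 T)] 0 := by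
    refine ae_eq_zero_of_integral_testFun isOpen_Ioo (hf.sub hK) fun ψ hψ => ?_
    -- subtracting a multiple of `ψ₀` from `ψ` leaves a test function with a primitive
    have hθ : IsTestFun (Ioo 0 T) (ψ + (-∫ s in Ioo 0 T, ψ s) • ψ₀) := hψ.add (hψ₀.smul _)
    have hiψ : IntegrableOn ψ (Ioo 0 T) :=
      (hψ.1.continuous.integrable_of_hasCompactSupport hψ.2.1).integrableOn
    have hiψ₀ : IntegrableOn ψ₀ (Ioo 0 T) :=
      (hψ₀.1.continuous.integrable_of_hasCompactSupport hψ₀.2.1).integrableOn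
    obtain ⟨φ, hφ, hφ'⟩ := hθ.exists_deriv_eq (by
      rw [← setIntegral_Ioo_eq_interval hT]
      simp only [Pi.add_apply, Pi.smul_apply, smul_eq_mul]
      rw [integral_add hiψ (hiψ₀.const_mul _), integral_const_mul, h1]
      ring)
    have h2 := h φ hφ
    rw [hφ'] at h2
    simp only [Pi.add_apply, Pi.smul_apply, smul_eq_mul, add_smul, mul_smul] at h2
    have h3 : IntegrableOn (fun s => (-∫ s in Ioo 0 T, ψ s) • ψ₀ s • f s) (Ioo 0 T) :=
      (hψ₀.integrableOn_smul hf).smul _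
    rw [integral_add (hψ.integrableOn_smul hf) h3, integral_smul] at h2
    simp only [smul_sub]
    rw [integral_sub (hψ.integrableOn_smul hf) (hψ.integrableOn_smul hK), integral_smul_const,
      ← h2, neg_smul, sub_eq_add_neg]
  filter_upwards [hz] with s hs
  exact sub_eq_zero.1 hs

/-- An element of `H¹_{0,•}(0,T;X)` is the primitive of its weak derivative. -/
lemma MemH1Zero.ae_eq_primitive {T : ℝ} (hT : 0 < T) {X : Type} [NormedAddCommGroup X]
    [NormedSpace ℝ X] [CompleteSpace X] {u : TimeL2 T X} (h : MemH1Zero u) :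
    u =ᵐ[volume.restrict (Ioo 0 T)] fun t => ∫ s in 0..t, timeDeriv u s := by
  have hu := h.hasWeakTimeDeriv
  obtain ⟨-, w, hwc, huw, hw0⟩ := h
  set u' := timeDeriv u
  have hu'i := intervalIntegrable_timeL2 hT u'
  have hac := hu'i.absolutelyContinuousOnInterval_primitive
  have hGc : ContinuousOn (fun t => ∫ s in 0..t, u' s) (Icc 0 T) := by
    have := hac.continuousOn
    rwa [uIcc_of_le hT.le] at this
  have hGi : IntegrableOn (fun t => ∫ s in 0..t, u' s) (Ioo 0 T) :=
    hGc.integrableOn_Icc.mono_set Ioo_subset_Icc_self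
  -- integration by parts for the primitive
  have hparts : ∀ φ : ℝ → ℝ, IsTestFun (Ioo 0 T) φ →
      ∫ s in Ioo 0 T, deriv φ s • (∫ r in 0..s, u' r) = -∫ s in Ioo 0 T, φ s • u' s := by
    intro φ hφ
    have h1 := hφ.isTestFun_deriv.integrableOn_smul hGi
    have h2 := hφ.integrableOn_smul (integrable_timeL2 u')
    have hφac : AbsolutelyContinuousOnInterval φ 0 T :=
      ContDiffOn.absolutelyContinuousOnInterval (hφ.1.of_le (by simp)).contDiffOn
    have h3 := integral_eq_sub_of_ae_hasDerivAt (hφac.smul hac)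
      (f' := fun s => φ s • u' s + deriv φ s • (∫ r in 0..s, u' r))
      (by
        filter_upwards [hu'i.ae_hasDerivAt_integral] with s hs hsm
        exact (hφ.differentiable s).hasDerivAt.smul (hs hsm 0 left_mem_uIcc))
      ((intervalIntegrable_iff_integrableOn_Ioo_of_le hT.le).2 (h2.add h1))
    rw [← setIntegral_Ioo_eq_interval hT, integral_add h2 h1] at h3
    have h0 : φ 0 = 0 := hφ.eq_zero_of_notMem (by simp)
    have hT' : φ T = 0 := hφ.eq_zero_of_notMem (by simp)
    simp only [Pi.smul_apply', h0, hT', zero_smul, sub_zero] at h3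
    exact eq_neg_of_add_eq_zero_right h3
  obtain ⟨K, hK⟩ := ae_eq_const_of_integral_deriv_testFun hT
    (f := fun t => u t - ∫ s in 0..t, u' s) ((integrable_timeL2 u).sub hGi) (by
      intro φ hφ
      simp only [smul_sub]
      rw [integral_sub (hφ.isTestFun_deriv.integrableOn_smul (integrable_timeL2 u))
        (hφ.isTestFun_deriv.integrableOn_smul hGi), hparts φ hφ, hu φ hφ, sub_self])
  -- the continuous function `w - ∫ u'` is constant almost everywhere, hence up to `t = 0`
  have hwK : ∀ t ∈ Icc 0 T, w t - (∫ s in 0..t, u' s) = K := by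
    have hae : (fun t => w t - ∫ s in 0..t, u' s) =ᵐ[volume.restrict (Icc 0 T)] fun _ => K := by
      rw [← Measure.restrict_congr_set Ioo_ae_eq_Icc]
      filter_upwards [hK, huw] with t h1 h2
      rw [← h2, h1]
    exact Measure.eqOn_Icc_of_ae_eq volume hT.ne hae (hwc.sub hGc) continuousOn_const
  have hK0 : K = 0 := by
    have := hwK 0 (left_mem_Icc.2 hT.le)
    simpa [hw0] using this.symm
  filter_upwards [hK] with t ht
  rw [hK0] at ht
  exact sub_eq_zero.1 ht

lemma MemH1Zero.eq_zero_of_timeDeriv_eq_zero {T : ℝ} (hT : 0 < T) {X : Type}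
    [NormedAddCommGroup X] [NormedSpace ℝ X] [CompleteSpace X] {u : TimeL2 T X}
    (h : MemH1Zero u) (h0 : timeDeriv u = 0) : u = 0 := by
  have hz : timeDeriv u =ᵐ[volume.restrict (Ioo 0 T)] 0 := by
    rw [h0]
    exact Lp.coeFn_zero _ _ _
  refine (Lp.eq_zero_iff_ae_eq_zero).2 ?_
  filter_upwards [h.ae_eq_primitive hT, ae_restrict_mem measurableSet_Ioo] with t ht htm
  rw [ht, intervalIntegral.integral_of_le htm.1.le]
  refine integral_eq_zero_of_ae (ae_restrict_of_ae_restrict_of_subset (fun s hs => ?_) hz)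
  exact ⟨hs.1, hs.2.trans_lt htm.2⟩

/-! ### The weighted inner product in time -/

/-- The inner product of `L²(0,T;Y)` with weight `e^{-t/T}`. -/
def weightedInner {T : ℝ} {Y : Type} [NormedAddCommGroup Y] [InnerProductSpace ℝ Y]
    (f g : TimeL2 T Y) : ℝ :=
  weightedInt T (fun s => ⟪f s, g s⟫)

lemma weightedInt_congr {T : ℝ} {f g : ℝ → ℝ} (h : f =ᵐ[volume.restrict (Ioo 0 T)] g) :
    weightedInt T f = weightedInt T g := by
  refine integral_congr_ae ?_
  filter_upwards [h] with s hs
  rw [hs]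

lemma integrableOn_inner_mul_exp {T : ℝ} (hT : 0 < T) {Y : Type} [NormedAddCommGroup Y]
    [InnerProductSpace ℝ Y] (f g : TimeL2 T Y) :
    IntegrableOn (fun s => ⟪f s, g s⟫ * Real.exp (-s / T)) (Ioo 0 T) := by
  refine Integrable.mul_bdd (c := 1) (L2.integrable_inner f g)
    (Continuous.aestronglyMeasurable (by fun_prop)) ?_
  filter_upwards [ae_restrict_mem measurableSet_Ioo] with s hs
  rw [Real.norm_of_nonneg (Real.exp_pos _).le, Real.exp_le_one_iff]
  exact div_nonpos_of_nonpos_of_nonneg (neg_nonpos.2 hs.1.le) hT.le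

/-- The energy estimate: `d/dt (‖u‖² e^{-t/T}) = 2 ⟪u, u'⟫ e^{-t/T} - T⁻¹ ‖u‖² e^{-t/T}`, whose
integral over `(0,T)` is `‖u(T)‖² e⁻¹ ≥ 0` because `u(0) = 0`. -/
lemma MemH1Zero.weightedInner_self_le {T : ℝ} (hT : 0 < T) {X Y : Type} [NormedAddCommGroup X]
    [NormedSpace ℝ X] [CompleteSpace X] [NormedAddCommGroup Y] [InnerProductSpace ℝ Y]
    [CompleteSpace Y] {u : TimeL2 T X} (h : MemH1Zero u) (L : X →L[ℝ] Y) :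
    weightedInner (timeMap L u) (timeMap L u) ≤
      2 * T * weightedInner (timeMap L u) (timeMap L (timeDeriv u)) := by
  unfold weightedInner
  have hui := intervalIntegrable_timeL2 hT (timeMap L (timeDeriv u))
  obtain ⟨G, hG⟩ : ∃ G : ℝ → Y, ∀ t, G t = ∫ s in 0..t, timeMap L (timeDeriv u) s :=
    ⟨_, fun _ => rfl⟩
  have hG' : G = fun t => ∫ s in 0..t, timeMap L (timeDeriv u) s := funext hG
  have hac : AbsolutelyContinuousOnInterval G 0 T := by
    rw [hG']
    exact hui.absolutelyContinuousOnInterval_primitive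
  have hGu : timeMap L u =ᵐ[volume.restrict (Ioo 0 T)] G := by
    filter_upwards [timeMap_ae L u, h.ae_eq_primitive hT, ae_restrict_mem measurableSet_Ioo]
      with t h1 h2 ht
    have hi : IntervalIntegrable (timeDeriv u) volume 0 t :=
      (intervalIntegrable_timeL2 hT (timeDeriv u)).mono_set
        (by rw [uIcc_of_le ht.1.le, uIcc_of_le hT.le]; exact Icc_subset_Icc_right ht.2.le)
    rw [h1, h2, hG, ← L.intervalIntegral_comp_comm hi]
    refine intervalIntegral.integral_congr_ae ?_
    filter_upwards [(ae_restrict_iff' measurableSet_Ioo).1 (timeMap_ae L (timeDeriv u))] with s hs hst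
    rw [uIoc_of_le ht.1.le] at hst
    exact (hs ⟨hst.1, hst.2.trans_lt ht.2⟩).symm
  have hsq : AbsolutelyContinuousOnInterval (fun t => ‖G t‖ ^ 2) 0 T := by
    obtain ⟨M, hM⟩ := hac.exists_bound
    refine absolutelyContinuousOnInterval_of_dist_le (hac.const_smul (2 * M)) fun x hx y hy => ?_
    have hx' := hM x hx
    have hy' := hM y hy
    have hM0 : 0 ≤ M := (norm_nonneg _).trans hx'
    rw [dist_smul₀, Real.dist_eq, sq_sub_sq, abs_mul, Real.norm_of_nonneg (by positivity),
      dist_eq_norm, abs_of_nonneg (by positivity)]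
    exact mul_le_mul (by linarith) (abs_norm_sub_norm_le _ _) (abs_nonneg _) (by positivity)
  have hexp : AbsolutelyContinuousOnInterval (fun t => Real.exp (-t / T)) 0 T :=
    ContDiffOn.absolutelyContinuousOnInterval
      (ContDiff.contDiffOn (Real.contDiff_exp.comp (contDiff_neg.div_const T)))
  have hi1 := integrableOn_inner_mul_exp hT (timeMap L u) (timeMap L (timeDeriv u))
  have hi2 := integrableOn_inner_mul_exp hT (timeMap L u) (timeMap L u)
  have key := integral_eq_sub_of_ae_hasDerivAt (hsq.mul hexp)
    (f' := fun s => 2 * ⟪G s, timeMap L (timeDeriv u) s⟫ * Real.exp (-s / T)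
      + ‖G s‖ ^ 2 * (Real.exp (-s / T) * (-1 / T)))
    (by
      filter_upwards [hui.ae_hasDerivAt_integral] with s hs hsm
      have h1 : HasDerivAt G (timeMap L (timeDeriv u) s) s := by
        rw [hG']
        exact hs hsm 0 left_mem_uIcc
      exact h1.norm_sq.mul (((hasDerivAt_id s).neg.div_const T).exp))
    ((intervalIntegrable_iff_integrableOn_Ioo_of_le hT.le).2 (by
      refine ((hi1.const_mul 2).add (hi2.const_mul (-1 / T))).congr ?_
      filter_upwards [hGu] with s hs
      simp only [Pi.add_apply, hs, real_inner_self_eq_norm_sq]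
      ring))
  have hG0 : G 0 = 0 := by rw [hG, intervalIntegral.integral_same]
  have hval : 2 * weightedInt T (fun s => ⟪timeMap L u s, timeMap L (timeDeriv u) s⟫)
      + (-1 / T) * weightedInt T (fun s => ⟪timeMap L u s, timeMap L u s⟫)
      = ‖G T‖ ^ 2 * Real.exp (-T / T) := by
    have hR : ((fun t => ‖G t‖ ^ 2) * fun t => Real.exp (-t / T)) T
        - ((fun t => ‖G t‖ ^ 2) * fun t => Real.exp (-t / T)) 0
        = ‖G T‖ ^ 2 * Real.exp (-T / T) := by
      simp [hG0]
    rw [← hR, ← key, ← setIntegral_Ioo_eq_interval hT, weightedInt, weightedInt,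
      ← integral_const_mul, ← integral_const_mul,
      ← integral_add (hi1.const_mul 2) (hi2.const_mul (-1 / T))]
    refine integral_congr_ae ?_
    filter_upwards [hGu] with s hs
    simp only [hs, real_inner_self_eq_norm_sq]
    ring
  have hpos : 0 ≤ ‖G T‖ ^ 2 * Real.exp (-T / T) := by positivity
  rw [← hval] at hpos
  have := mul_nonneg hT.le hpos
  field_simp at this
  nlinarith

lemma weightedInner_comm {T : ℝ} {Y : Type} [NormedAddCommGroup Y] [InnerProductSpace ℝ Y]
    (f g : TimeL2 T Y) : weightedInner f g = weightedInner g f :=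
  weightedInt_congr (.of_forall fun _ => real_inner_comm _ _)

lemma weightedInner_add_left {T : ℝ} (hT : 0 < T) {Y : Type} [NormedAddCommGroup Y]
    [InnerProductSpace ℝ Y] (f g h : TimeL2 T Y) :
    weightedInner (f + g) h = weightedInner f h + weightedInner g h := by
  rw [weightedInner, weightedInner, weightedInner, weightedInt, weightedInt, weightedInt,
    ← integral_add (integrableOn_inner_mul_exp hT f h) (integrableOn_inner_mul_exp hT g h)]
  refine integral_congr_ae ?_
  filter_upwards [Lp.coeFn_add f g] with s hs
  rw [hs, Pi.add_apply, inner_add_left, add_mul]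

lemma weightedInner_smul_left {T : ℝ} {Y : Type} [NormedAddCommGroup Y]
    [InnerProductSpace ℝ Y] (a : ℝ) (f g : TimeL2 T Y) :
    weightedInner (a • f) g = a * weightedInner f g := by
  rw [weightedInner, weightedInner, weightedInt, weightedInt, ← integral_const_mul]
  refine integral_congr_ae ?_
  filter_upwards [Lp.coeFn_smul a f] with s hs
  rw [hs, Pi.smul_apply, real_inner_smul_left, mul_assoc]

lemma weightedInner_neg_left {T : ℝ} {Y : Type} [NormedAddCommGroup Y]
    [InnerProductSpace ℝ Y] (f g : TimeL2 T Y) :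
    weightedInner (-f) g = -weightedInner f g := by
  rw [← neg_one_smul ℝ f, weightedInner_smul_left, neg_one_mul]

lemma weightedInner_add_right {T : ℝ} (hT : 0 < T) {Y : Type} [NormedAddCommGroup Y]
    [InnerProductSpace ℝ Y] (f g h : TimeL2 T Y) :
    weightedInner f (g + h) = weightedInner f g + weightedInner f h := by
  simp only [weightedInner_comm f, weightedInner_add_left hT]

lemma weightedInner_smul_right {T : ℝ} {Y : Type} [NormedAddCommGroup Y]
    [InnerProductSpace ℝ Y] (a : ℝ) (f g : TimeL2 T Y) :
    weightedInner f (a • g) = a * weightedInner f g := by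
  simp only [weightedInner_comm f, weightedInner_smul_left]

lemma weightedInner_neg_right {T : ℝ} {Y : Type} [NormedAddCommGroup Y]
    [InnerProductSpace ℝ Y] (f g : TimeL2 T Y) :
    weightedInner f (-g) = -weightedInner f g := by
  simp only [weightedInner_comm f, weightedInner_neg_left]

lemma weightedInner_self_nonneg {T : ℝ} {Y : Type} [NormedAddCommGroup Y]
    [InnerProductSpace ℝ Y] (f : TimeL2 T Y) : 0 ≤ weightedInner f f :=
  integral_nonneg fun _ => mul_nonneg real_inner_self_nonneg (Real.exp_pos _).le

lemma eq_zero_of_weightedInner_self {T : ℝ} (hT : 0 < T) {Y : Type} [NormedAddCommGroup Y]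
    [InnerProductSpace ℝ Y] {f : TimeL2 T Y} (h : weightedInner f f = 0) : f = 0 := by
  refine (Lp.eq_zero_iff_ae_eq_zero).2 ?_
  have h0 := (integral_eq_zero_iff_of_nonneg
    (fun s => mul_nonneg real_inner_self_nonneg (Real.exp_pos (-s / T)).le)
    (integrableOn_inner_mul_exp hT f f)).1 h
  filter_upwards [h0] with s hs
  exact inner_self_eq_zero.1 ((mul_eq_zero.1 hs).resolve_right (Real.exp_pos _).ne')

lemma weightedInner_self_le_of_norm_le {T : ℝ} (hT : 0 < T) {Y Z : Type} [NormedAddCommGroup Y]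
    [InnerProductSpace ℝ Y] [NormedAddCommGroup Z] [InnerProductSpace ℝ Z] {f : TimeL2 T Y}
    {g : TimeL2 T Z} {K : ℝ}
    (h : ∀ᵐ s ∂(volume.restrict (Ioo 0 T)), ‖f s‖ ≤ K * ‖g s‖) :
    weightedInner f f ≤ K ^ 2 * weightedInner g g := by
  rw [weightedInner, weightedInner, weightedInt, weightedInt, ← integral_const_mul]
  refine integral_mono_ae (integrableOn_inner_mul_exp hT f f)
    ((integrableOn_inner_mul_exp hT g g).const_mul _) ?_
  filter_upwards [h] with s hs
  have h2 := pow_le_pow_left₀ (norm_nonneg _) hs 2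
  rw [mul_pow] at h2
  simp only [real_inner_self_eq_norm_sq, ← mul_assoc]
  exact mul_le_mul_of_nonneg_right h2 (Real.exp_pos _).le

/-! ### Test functions in the Sobolev space -/

lemma IsTestFun.continuous_gradient {d : ℕ} {Ω : Set (Vec d)} {φ : Vec d → ℝ}
    (hφ : IsTestFun Ω φ) : Continuous fun x => ∇ φ x :=
  (InnerProductSpace.toDual ℝ (Vec d)).symm.continuous.comp (hφ.1.continuous_fderiv (by simp))

lemma IsTestFun.hasCompactSupport_gradient {d : ℕ} {Ω : Set (Vec d)} {φ : Vec d → ℝ}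
    (hφ : IsTestFun Ω φ) : HasCompactSupport fun x => ∇ φ x :=
  (hφ.2.1.fderiv (𝕜 := ℝ)).mono fun x hx h0 => hx (by simp [gradient, h0])

lemma IsTestFun.memLp {d : ℕ} {Ω : Set (Vec d)} {φ : Vec d → ℝ} (hφ : IsTestFun Ω φ) :
    MemLp φ 2 (volume.restrict Ω) :=
  (hφ.1.continuous.memLp_of_hasCompactSupport hφ.2.1).restrict Ω

lemma IsTestFun.memLp_gradient {d : ℕ} {Ω : Set (Vec d)} {φ : Vec d → ℝ} (hφ : IsTestFun Ω φ) :
    MemLp (fun x => ∇ φ x) 2 (volume.restrict Ω) :=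
  (hφ.continuous_gradient.memLp_of_hasCompactSupport hφ.hasCompactSupport_gradient).restrict Ω

lemma IsTestFun.exists_toL2_ae_eq {d : ℕ} {Ω : Set (Vec d)} {φ : Vec d → ℝ}
    (hφ : IsTestFun Ω φ) : ∃ v : H10 Ω, toL2 Ω v =ᵐ[volume.restrict Ω] φ := by
  refine ⟨⟨WithLp.toLp 2 (hφ.memLp.toLp φ, hφ.memLp_gradient.toLp _),
    (testGraph Ω).le_topologicalClosure
      ⟨φ, hφ, hφ.memLp.coeFn_toLp, hφ.memLp_gradient.coeFn_toLp⟩⟩, ?_⟩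
  exact hφ.memLp.coeFn_toLp

lemma integrableOn_Lp_two {d : ℕ} {Ω : Set (Vec d)} (hΩ : Bornology.IsBounded Ω) {X : Type*}
    [NormedAddCommGroup X] (f : Lp X 2 (volume.restrict Ω)) : IntegrableOn f Ω := by
  have : IsFiniteMeasure (volume.restrict Ω) := ⟨by
    rw [Measure.restrict_apply_univ]
    exact hΩ.measure_lt_top⟩
  exact (Lp.memLp f).integrable one_le_two

/-- Test functions are dense in `L²(Ω)`. -/
lemma toDual_injective {d : ℕ} {Ω : Set (Vec d)} (hΩo : IsOpen Ω) (hΩ : Bornology.IsBounded Ω) :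
    Function.Injective (toDual Ω) := by
  refine (injective_iff_map_eq_zero _).2 fun f hf => ?_
  refine (Lp.eq_zero_iff_ae_eq_zero).2
    (ae_eq_zero_of_integral_testFun hΩo (integrableOn_Lp_two hΩ f) fun φ hφ => ?_)
  obtain ⟨v, hv⟩ := hφ.exists_toL2_ae_eq
  have h : ⟪f, toL2 Ω v⟫ = 0 := by rw [← toDual_apply, hf]; rfl
  rw [← h, L2.inner_def]
  refine integral_congr_ae ?_
  filter_upwards [hv] with x hx
  rw [hx]
  rfl

/-- The second component of an element of `H₀¹(Ω)` is the weak gradient of the first. -/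
lemma integral_smul_grad_eq {d : ℕ} {Ω : Set (Vec d)} (hΩ : Bornology.IsBounded Ω)
    {φ : Vec d → ℝ} (hφ : IsTestFun Ω φ) (v : H10 Ω) :
    ∫ x in Ω, φ x • grad Ω v x = -∫ x in Ω, toL2 Ω v x • ∇ φ x := by
  refine ext_inner_left ℝ fun e => ?_
  have hφe : MemLp (fun x => φ x • e) 2 (volume.restrict Ω) :=
    ((hφ.1.continuous.smul continuous_const).memLp_of_hasCompactSupport
      (hφ.2.1.mono fun x hx h0 => hx (by simp [h0]))).restrict Ω
  have hde : MemLp (fun x => ⟪e, ∇ φ x⟫) 2 (volume.restrict Ω) :=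
    ((continuous_const.inner hφ.continuous_gradient).memLp_of_hasCompactSupport
      (hφ.hasCompactSupport_gradient.mono fun x hx h0 => hx (by
        have h0' : ∇ φ x = 0 := h0
        simp [h0']))).restrict Ω
  -- tested against a fixed direction `e`, the identity is a closed condition on `(v, ∇v)`
  have hcl : IsClosed {p : PairSpace Ω | ⟪hφe.toLp _, p.snd⟫ + ⟪hde.toLp _, p.fst⟫ = 0} :=
    isClosed_eq ((continuous_const.inner (WithLp.sndL 2 ℝ (L2 Ω) (L2Vec Ω)).continuous).add
      (continuous_const.inner (WithLp.fstL 2 ℝ (L2 Ω) (L2Vec Ω)).continuous)) continuous_const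
  have hsub : (testGraph Ω : Set (PairSpace Ω)) ⊆
      {p | ⟪hφe.toLp _, p.snd⟫ + ⟪hde.toLp _, p.fst⟫ = 0} := by
    rintro p ⟨ψ, hψ, h1, h2⟩
    have e1 : ⟪hφe.toLp _, p.snd⟫ = ∫ x, φ x * fderiv ℝ ψ x e := by
      rw [L2.inner_def,
        ← setIntegral_eq_integral_of_forall_compl_eq_zero (s := Ω)
          (f := fun x => φ x * fderiv ℝ ψ x e) fun x hx => by rw [hφ.eq_zero_of_notMem hx, zero_mul]]
      refine integral_congr_ae ?_
      filter_upwards [h2, hφe.coeFn_toLp] with x h3 h4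
      rw [h3, h4, real_inner_smul_left, real_inner_comm, inner_gradient_left]
    have e2 : ⟪hde.toLp _, p.fst⟫ = ∫ x, fderiv ℝ φ x e * ψ x := by
      rw [L2.inner_def,
        ← setIntegral_eq_integral_of_forall_compl_eq_zero (s := Ω)
          (f := fun x => fderiv ℝ φ x e * ψ x) fun x hx => by rw [hψ.eq_zero_of_notMem hx, mul_zero]]
      refine integral_congr_ae ?_
      filter_upwards [h1, hde.coeFn_toLp] with x h3 h4
      rw [h3, h4]
      change ψ x * ⟪e, ∇ φ x⟫ = _
      rw [real_inner_comm, inner_gradient_left, mul_comm]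
    have hφc := hφ.1.continuous
    have hψc := hψ.1.continuous
    have hφd : Continuous fun x => fderiv ℝ φ x e :=
      (hφ.1.continuous_fderiv (by simp)).clm_apply continuous_const
    have hψd : Continuous fun x => fderiv ℝ ψ x e :=
      (hψ.1.continuous_fderiv (by simp)).clm_apply continuous_const
    have key := integral_mul_fderiv_eq_neg_fderiv_mul_of_integrable
      (μ := (volume : Measure (Vec d))) (f := φ) (g := ψ) (v := e)
      ((hφd.mul hψc).integrable_of_hasCompactSupport
        (hψ.2.1.mono fun x hx h0 => hx (by simp [h0])))
      ((hφc.mul hψd).integrable_of_hasCompactSupport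
        (hφ.2.1.mono fun x hx h0 => hx (by simp [h0])))
      ((hφc.mul hψc).integrable_of_hasCompactSupport
        (hφ.2.1.mono fun x hx h0 => hx (by simp [h0])))
      (fun x _ => hφ.differentiable x) (fun x _ => hψ.differentiable x)
    change _ + _ = _
    rw [e1, e2, key, neg_add_cancel]
  have hv : ⟪hφe.toLp _, grad Ω v⟫ + ⟪hde.toLp _, toL2 Ω v⟫ = 0 := closure_minimal hsub hcl v.2
  have hi1 : IntegrableOn (fun x => φ x • grad Ω v x) Ω := by
    obtain ⟨K, hK⟩ := hφ.2.1.exists_bound_of_continuous hφ.1.continuous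
    exact Integrable.bdd_smul (integrableOn_Lp_two hΩ _) K
      hφ.1.continuous.aestronglyMeasurable (.of_forall hK)
  have hi2 : IntegrableOn (fun x => toL2 Ω v x • ∇ φ x) Ω := by
    obtain ⟨K, hK⟩ := hφ.hasCompactSupport_gradient.exists_bound_of_continuous
      hφ.continuous_gradient
    exact Integrable.smul_bdd (μ := volume.restrict Ω) (integrableOn_Lp_two hΩ (toL2 Ω v)) K
      hφ.continuous_gradient.aestronglyMeasurable (.of_forall hK)
  rw [inner_neg_right, ← integral_inner hi1, ← integral_inner hi2, eq_neg_iff_add_eq_zero, ← hv,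
    L2.inner_def, L2.inner_def]
  congr 1
  · refine integral_congr_ae ?_
    filter_upwards [hφe.coeFn_toLp] with x hx
    rw [hx, real_inner_smul_left, real_inner_smul_right]
  · refine integral_congr_ae ?_
    filter_upwards [hde.coeFn_toLp] with x hx
    rw [hx, real_inner_smul_right]
    rfl

/-- An element of `H₀¹(Ω)` is determined by its class in `L²(Ω)`. -/
lemma toL2_injective {d : ℕ} {Ω : Set (Vec d)} (hΩo : IsOpen Ω) (hΩ : Bornology.IsBounded Ω) :
    Function.Injective (toL2 Ω) := by
  refine (injective_iff_map_eq_zero _).2 fun v hv => ?_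
  have hg : grad Ω v = 0 := by
    refine (Lp.eq_zero_iff_ae_eq_zero).2
      (ae_eq_zero_of_integral_testFun hΩo (integrableOn_Lp_two hΩ _) fun φ hφ => ?_)
    rw [integral_smul_grad_eq hΩ hφ, neg_eq_zero]
    refine integral_eq_zero_of_ae ?_
    have h0 : toL2 Ω v =ᵐ[volume.restrict Ω] 0 := by
      rw [hv]
      exact Lp.coeFn_zero _ _ _
    filter_upwards [h0] with x hx
    simp [hx]
  refine Subtype.ext (WithLp.ofLp_injective 2 (Prod.ext hv hg))

/-! ### The Newton potential and the scaled gradient -/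

/-- The operator `u ↦ c ∇u` from `H₀¹(Ω)` to `L²(Ω)ᵈ`. -/
def scaledGrad {d : ℕ} {Ω : Set (Vec d)} {c : Vec d → ℝ}
    (hc : MemLp c ∞ (volume.restrict Ω)) : H10 Ω →L[ℝ] L2Vec Ω :=
  (mulCoeff hc).comp (grad Ω)

lemma inner_scaledGrad {d : ℕ} {Ω : Set (Vec d)} {c : Vec d → ℝ}
    (hc : MemLp c ∞ (volume.restrict Ω)) (u v : H10 Ω) :
    ⟪scaledGrad hc u, scaledGrad hc v⟫ = energy Ω c u v :=
  energyForm_apply hc u v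

lemma energyNormSq_eq_energy {d : ℕ} (Ω : Set (Vec d)) (c : Vec d → ℝ) (u : H10 Ω) :
    energyNormSq Ω c u = energy Ω c u u := by
  refine integral_congr_ae (.of_forall fun x => ?_)
  simp only [norm_smul, mul_pow, Real.norm_eq_abs, sq_abs, real_inner_smul_left,
    real_inner_self_eq_norm_sq]

section Newton

variable {d : ℕ} (hd : 0 < d) {Ω : Set (Vec d)} (hΩ : Bornology.IsBounded Ω)
  {c : Vec d → ℝ} {c₀ : ℝ} (hc : IsWaveSpeed Ω c c₀)

lemma newtonNormSq_eq_inner (f : H10Dual Ω) :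
    newtonNormSq hd hΩ hc f =
      ⟪scaledGrad hc.memLp (newton hd hΩ hc f), scaledGrad hc.memLp (newton hd hΩ hc f)⟫ := by
  rw [inner_scaledGrad, energy_newton]
  rfl

lemma inner_scaledGrad_newton (f : L2 Ω) (v : H10 Ω) :
    ⟪scaledGrad hc.memLp (newton hd hΩ hc (toDual Ω f)), scaledGrad hc.memLp v⟫ =
      ⟪f, toL2 Ω v⟫ := by
  rw [inner_scaledGrad, energy_newton, toDual_apply]

lemma norm_toL2_le {C : ℝ} (hC : IsPoincareConst Ω C) (v : H10 Ω) :
    ‖toL2 Ω v‖ ≤ C / c₀ * ‖scaledGrad hc.memLp v‖ := by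
  have h0 := hc.pos
  have h1 : c₀ * ‖grad Ω v‖ ≤ ‖scaledGrad hc.memLp v‖ := by
    have : ‖c₀ • grad Ω v‖ ≤ ‖mulCoeff hc.memLp (grad Ω v)‖ := by
      refine Lp.norm_le_norm_of_ae_le ?_
      filter_upwards [mulCoeff_ae hc.memLp (grad Ω v), Lp.coeFn_smul c₀ (grad Ω v), hc.le]
        with x h2 h3 h4
      rw [h2, h3, Pi.smul_apply, norm_smul, norm_smul, Real.norm_of_nonneg h0.le,
        Real.norm_of_nonneg (h0.le.trans h4)]
      exact mul_le_mul_of_nonneg_right h4 (norm_nonneg _)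
    rwa [norm_smul, Real.norm_of_nonneg h0.le] at this
  calc ‖toL2 Ω v‖ ≤ C * ‖grad Ω v‖ := hC.2 v
    _ = C / c₀ * (c₀ * ‖grad Ω v‖) := by field_simp
    _ ≤ C / c₀ * ‖scaledGrad hc.memLp v‖ :=
      mul_le_mul_of_nonneg_left h1 (div_nonneg hC.1.le h0.le)

/-- The dual form of `norm_toL2_le`. -/
lemma norm_scaledGrad_newton_le {C : ℝ} (hC : IsPoincareConst Ω C) (f : L2 Ω) :
    ‖scaledGrad hc.memLp (newton hd hΩ hc (toDual Ω f))‖ ≤ C / c₀ * ‖f‖ := by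
  set v := newton hd hΩ hc (toDual Ω f)
  have h1 : ‖scaledGrad hc.memLp v‖ ^ 2 ≤ ‖f‖ * (C / c₀ * ‖scaledGrad hc.memLp v‖) := by
    rw [← real_inner_self_eq_norm_sq, inner_scaledGrad_newton hd hΩ hc f v]
    exact (real_inner_le_norm _ _).trans
      (mul_le_mul_of_nonneg_left (norm_toL2_le hc hC v) (norm_nonneg _))
  rcases (norm_nonneg (scaledGrad hc.memLp v)).eq_or_lt with h | h
  · rw [← h]
    exact mul_nonneg (div_nonneg hC.1.le hc.pos.le) (norm_nonneg _)
  · refine le_of_mul_le_mul_right ?_ h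
    nlinarith

lemma toDual_eq_zero_of_scaledGrad_newton {f : L2 Ω}
    (h : scaledGrad hc.memLp (newton hd hΩ hc (toDual Ω f)) = 0) : toDual Ω f = 0 := by
  ext v
  rw [toDual_apply, ← inner_scaledGrad_newton hd hΩ hc, h, inner_zero_left]
  rfl

end Newton

/-! ### Composition with bounded operators in time -/

lemma timeMap_add {T : ℝ} {X Y : Type} [NormedAddCommGroup X] [NormedSpace ℝ X]
    [NormedAddCommGroup Y] [NormedSpace ℝ Y] (L : X →L[ℝ] Y) (u v : TimeL2 T X) :
    timeMap L (u + v) = timeMap L u + timeMap L v :=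
  map_add (L.compLpL 2 (volume.restrict (Ioo 0 T))) u v

lemma timeMap_smul {T : ℝ} {X Y : Type} [NormedAddCommGroup X] [NormedSpace ℝ X]
    [NormedAddCommGroup Y] [NormedSpace ℝ Y] (L : X →L[ℝ] Y) (a : ℝ) (u : TimeL2 T X) :
    timeMap L (a • u) = a • timeMap L u :=
  map_smul (L.compLpL 2 (volume.restrict (Ioo 0 T))) a u

lemma timeMap_neg {T : ℝ} {X Y : Type} [NormedAddCommGroup X] [NormedSpace ℝ X]
    [NormedAddCommGroup Y] [NormedSpace ℝ Y] (L : X →L[ℝ] Y) (u : TimeL2 T X) :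
    timeMap L (-u) = -timeMap L u :=
  map_neg (L.compLpL 2 (volume.restrict (Ioo 0 T))) u

lemma timeMap_id {T : ℝ} {X : Type} [NormedAddCommGroup X] [NormedSpace ℝ X]
    (u : TimeL2 T X) : timeMap (ContinuousLinearMap.id ℝ X) u = u :=
  Lp.ext (timeMap_ae _ u)

lemma eq_zero_of_timeMap_eq_zero {T : ℝ} {X Y : Type} [NormedAddCommGroup X] [NormedSpace ℝ X]
    [NormedAddCommGroup Y] [NormedSpace ℝ Y] {L : X →L[ℝ] Y} {u : TimeL2 T X}
    (hL : ∀ x, L x = 0 → x = 0) (h : timeMap L u = 0) : u = 0 := by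
  refine (Lp.eq_zero_iff_ae_eq_zero).2 ?_
  filter_upwards [timeMap_ae L u, (Lp.eq_zero_iff_ae_eq_zero).1 h] with s h1 h2
  exact hL _ (h1.symm.trans h2)

/-! ### Algebra of the estimate -/

/-- The square of the test norm: by the hypothesis `h`, the cross terms of the two squares
cancel. -/
lemma weightedInner_test_add {T : ℝ} (hT : 0 < T) {Y Z : Type} [NormedAddCommGroup Y]
    [InnerProductSpace ℝ Y] [NormedAddCommGroup Z] [InnerProductSpace ℝ Z] {p m : TimeL2 T Y}
    {Lk Ln : TimeL2 T Z} (h : weightedInner p m = weightedInner Lk Ln) :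
    weightedInner (m + (2 * T) • p) (m + (2 * T) • p)
        + weightedInner (-Lk + (2 * T) • Ln) (-Lk + (2 * T) • Ln) =
      weightedInner m m + 4 * T ^ 2 * weightedInner p p
        + weightedInner Lk Lk + 4 * T ^ 2 * weightedInner Ln Ln := by
  simp only [weightedInner_add_left hT, weightedInner_add_right hT, weightedInner_smul_left,
    weightedInner_smul_right, weightedInner_neg_left, weightedInner_neg_right]
  rw [weightedInner_comm m p, weightedInner_comm Ln Lk, h]
  ring

/-- The coercivity estimate. After the energy inequalities `hu` and `hv` the difference of the two
sides is at least half of `‖Ln + Lu‖² + ‖p - v‖²`. -/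
lemma half_le_of_energy {T : ℝ} (hT : 0 < T) {Y Z : Type} [NormedAddCommGroup Y]
    [InnerProductSpace ℝ Y] [NormedAddCommGroup Z] [InnerProductSpace ℝ Z]
    {p q m v : TimeL2 T Y} {Ln Lu Lu' : TimeL2 T Z}
    (hqm : weightedInner q m = weightedInner Ln Ln)
    (hu : weightedInner Lu Lu ≤ 2 * T * weightedInner Lu Lu')
    (hv : weightedInner v v ≤ 2 * T * weightedInner v q) :
    (weightedInner p p + weightedInner Ln Ln + weightedInner Lu Lu + weightedInner v v) / 2 ≤
      weightedInner q (m + (2 * T) • p) + weightedInner Lu (Ln + (2 * T) • Lu')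
        - weightedInner p (-p + (2 * T) • q) + weightedInner v (-p + (2 * T) • q) := by
  have h1 := weightedInner_self_nonneg (Ln + Lu)
  have h2 := weightedInner_self_nonneg (p + -v)
  simp only [weightedInner_add_left hT, weightedInner_add_right hT, weightedInner_smul_right,
    weightedInner_neg_left, weightedInner_neg_right] at h1 h2 ⊢
  rw [weightedInner_comm q p, hqm]
  rw [weightedInner_comm Ln Lu] at h1
  rw [weightedInner_comm p v] at h2
  linarith

lemma one_div_le_div_sqrt_mul_sqrt {A v w K : ℝ} (hv : 0 < v) (hw : 0 < w) (hK : 0 < K)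
    (hA : v / 2 ≤ A) (hwv : w ≤ K * v) :
    1 / (2 * Real.sqrt K) ≤ A / (Real.sqrt v * Real.sqrt w) := by
  have hsv := Real.sqrt_pos.2 hv
  have hsw := Real.sqrt_pos.2 hw
  have hsK := Real.sqrt_pos.2 hK
  have hle : Real.sqrt w ≤ Real.sqrt K * Real.sqrt v := by
    rw [← Real.sqrt_mul hK.le]
    exact Real.sqrt_le_sqrt hwv
  rw [div_le_div_iff₀ (by positivity) (by positivity), one_mul]
  calc Real.sqrt v * Real.sqrt w
      ≤ Real.sqrt v * (Real.sqrt K * Real.sqrt v) := mul_le_mul_of_nonneg_left hle hsv.le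
    _ = v / 2 * (2 * Real.sqrt K) := by
        rw [mul_left_comm, Real.mul_self_sqrt hv.le]
        ring
    _ ≤ _ := mul_le_mul_of_nonneg_right hA (by positivity)

/-! ### The forms in terms of weighted inner products -/

section Forms

variable {d : ℕ} (hd : 0 < d) {Ω : Set (Vec d)} (hΩ : Bornology.IsBounded Ω)
  {c : Vec d → ℝ} {c₀ : ℝ} (hc : IsWaveSpeed Ω c c₀) {T : ℝ}

/-- The function `s ↦ c ∇ (N f(s))` for `f ∈ L²(Q_T)`. -/
def scaledGradNewton (f : TimeL2 T (L2 Ω)) : TimeL2 T (L2Vec Ω) :=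
  timeMap (scaledGrad hc.memLp) (timeMap (newton hd hΩ hc)
    (timeMap (Y := H10Dual Ω) (toDual Ω) f))

lemma scaledGradNewton_ae (f : TimeL2 T (L2 Ω)) :
    scaledGradNewton hd hΩ hc f =ᵐ[volume.restrict (Ioo 0 T)]
      fun s => scaledGrad hc.memLp (newton hd hΩ hc (toDual Ω (f s))) := by
  filter_upwards [timeMap_ae (scaledGrad hc.memLp) (timeMap (newton hd hΩ hc)
      (timeMap (Y := H10Dual Ω) (toDual Ω) f)),
    timeMap_ae (newton hd hΩ hc) (timeMap (Y := H10Dual Ω) (toDual Ω) f),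
    timeMap_ae (Y := H10Dual Ω) (toDual Ω) f] with s h1 h2 h3
  rw [scaledGradNewton, h1, h2, h3]

lemma weightedInner_scaledGradNewton (f : TimeL2 T (L2 Ω)) (v : TimeL2 T (H10 Ω)) :
    weightedInner (scaledGradNewton hd hΩ hc f) (timeMap (scaledGrad hc.memLp) v) =
      weightedInner f (timeMap (toL2 Ω) v) := by
  refine weightedInt_congr ?_
  filter_upwards [scaledGradNewton_ae hd hΩ hc f, timeMap_ae (scaledGrad hc.memLp) v,
    timeMap_ae (toL2 Ω) v] with s h1 h2 h3
  rw [h1, h2, h3, inner_scaledGrad_newton]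

lemma weightedInt_newtonNormSq (f : TimeL2 T (L2 Ω)) :
    weightedInt T (fun s => newtonNormSq hd hΩ hc (toDual Ω (f s))) =
      weightedInner (scaledGradNewton hd hΩ hc f) (scaledGradNewton hd hΩ hc f) := by
  refine weightedInt_congr ?_
  filter_upwards [scaledGradNewton_ae hd hΩ hc f] with s h1
  rw [h1, newtonNormSq_eq_inner]

lemma bilinA_eq {U : TimeL2 T (H10 Ω)} {V : TimeL2 T (L2 Ω)} (hU : MemH1Zero U)
    (hV : MemH1Zero V) (lam : TimeL2 T (H10 Ω)) (chi : TimeL2 T (L2 Ω)) :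
    bilinA c U V lam chi =
      weightedInner (timeDeriv V) (timeMap (toL2 Ω) lam)
      + weightedInner (timeMap (scaledGrad hc.memLp) U) (timeMap (scaledGrad hc.memLp) lam)
      - weightedInner (timeMap (toL2 Ω) (timeDeriv U)) chi + weightedInner V chi := by
  rw [bilinA, hU.timeDeriv_timeMap, hV.timeDeriv_timeMap]
  congr 3
  · refine weightedInt_congr ?_
    filter_upwards [timeMap_ae (Y := H10Dual Ω) (toDual Ω) (timeDeriv V),
      timeMap_ae (toL2 Ω) lam] with s h1 h2
    rw [h1, h2, toDual_apply]
  · refine weightedInt_congr ?_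
    filter_upwards [timeMap_ae (scaledGrad hc.memLp) U,
      timeMap_ae (scaledGrad hc.memLp) lam] with s h1 h2
    rw [h1, h2, inner_scaledGrad]

lemma normV_eq {U : TimeL2 T (H10 Ω)} {V : TimeL2 T (L2 Ω)} (hU : MemH1Zero U)
    (hV : MemH1Zero V) :
    normV hd hΩ hc U V = Real.sqrt
      (weightedInner (timeMap (toL2 Ω) (timeDeriv U)) (timeMap (toL2 Ω) (timeDeriv U))
      + weightedInner (scaledGradNewton hd hΩ hc (timeDeriv V))
        (scaledGradNewton hd hΩ hc (timeDeriv V))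
      + weightedInner (timeMap (scaledGrad hc.memLp) U) (timeMap (scaledGrad hc.memLp) U)
      + weightedInner V V) := by
  rw [normV, hU.timeDeriv_timeMap, hV.timeDeriv_timeMap]
  congr 1
  congr 1
  · congr 1
    · congr 1
      · exact weightedInt_congr (.of_forall fun s => (real_inner_self_eq_norm_sq _).symm)
      · rw [← weightedInt_newtonNormSq]
        refine weightedInt_congr ?_
        filter_upwards [timeMap_ae (Y := H10Dual Ω) (toDual Ω) (timeDeriv V)] with s h1
        rw [h1]
    · refine weightedInt_congr ?_
      filter_upwards [timeMap_ae (scaledGrad hc.memLp) U] with s h1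
      rw [h1, inner_scaledGrad, energyNormSq_eq_energy]
  · exact weightedInt_congr (.of_forall fun s => (real_inner_self_eq_norm_sq _).symm)

lemma normW_eq (lam : TimeL2 T (H10 Ω)) (chi : TimeL2 T (L2 Ω)) :
    normW hd hΩ hc lam chi = Real.sqrt
      (weightedInner (timeMap (toL2 Ω) lam) (timeMap (toL2 Ω) lam)
      + weightedInner (scaledGradNewton hd hΩ hc chi) (scaledGradNewton hd hΩ hc chi)) := by
  rw [normW, weightedInt_newtonNormSq]
  congr 2
  refine weightedInt_congr ?_
  filter_upwards [timeMap_ae (toL2 Ω) lam] with s h1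
  rw [h1, real_inner_self_eq_norm_sq]

/-- The part of the trial norm that involves time derivatives is already a norm, because of the
zero initial values. -/
lemma weightedInner_derivatives_pos (hΩo : IsOpen Ω) (hT : 0 < T) {U : TimeL2 T (H10 Ω)}
    {V : TimeL2 T (L2 Ω)} (hU : MemH1Zero U) (hV : MemH1Zero V) (hUV : ¬(U = 0 ∧ V = 0)) :
    0 < weightedInner (timeMap (toL2 Ω) (timeDeriv U)) (timeMap (toL2 Ω) (timeDeriv U))
      + weightedInner (scaledGradNewton hd hΩ hc (timeDeriv V))
        (scaledGradNewton hd hΩ hc (timeDeriv V)) := by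
  have h1 := weightedInner_self_nonneg (timeMap (toL2 Ω) (timeDeriv U))
  have h2 := weightedInner_self_nonneg (scaledGradNewton hd hΩ hc (timeDeriv V))
  refine lt_of_le_of_ne (add_nonneg h1 h2) fun h0 => hUV ⟨?_, ?_⟩
  · have h3 : timeMap (toL2 Ω) (timeDeriv U) = 0 :=
      eq_zero_of_weightedInner_self hT (by linarith)
    have h4 : timeDeriv U = 0 := eq_zero_of_timeMap_eq_zero
      (fun x hx => (injective_iff_map_eq_zero _).1 (toL2_injective hΩo hΩ) x hx) h3
    exact hU.eq_zero_of_timeDeriv_eq_zero hT h4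
  · have h3 : scaledGradNewton hd hΩ hc (timeDeriv V) = 0 :=
      eq_zero_of_weightedInner_self hT (by linarith)
    have h4 : timeDeriv V = 0 := by
      refine (Lp.eq_zero_iff_ae_eq_zero).2 ?_
      filter_upwards [scaledGradNewton_ae hd hΩ hc (timeDeriv V),
        (Lp.eq_zero_iff_ae_eq_zero).1 h3] with s h5 h6
      exact (injective_iff_map_eq_zero _).1 (toDual_injective hΩo hΩ) _
        (toDual_eq_zero_of_scaledGrad_newton hd hΩ hc (h5.symm.trans h6))
    exact hV.eq_zero_of_timeDeriv_eq_zero hT h4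

lemma weightedInner_timeMap_toL2_le (hT : 0 < T) {C : ℝ} (hC : IsPoincareConst Ω C)
    (v : TimeL2 T (H10 Ω)) :
    weightedInner (timeMap (toL2 Ω) v) (timeMap (toL2 Ω) v) ≤
      (C / c₀) ^ 2 * weightedInner (timeMap (scaledGrad hc.memLp) v)
        (timeMap (scaledGrad hc.memLp) v) := by
  refine weightedInner_self_le_of_norm_le hT ?_
  filter_upwards [timeMap_ae (toL2 Ω) v, timeMap_ae (scaledGrad hc.memLp) v] with s h1 h2
  rw [h1, h2]
  exact norm_toL2_le hc hC _

lemma weightedInner_scaledGradNewton_le (hT : 0 < T) {C : ℝ} (hC : IsPoincareConst Ω C)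
    (f : TimeL2 T (L2 Ω)) :
    weightedInner (scaledGradNewton hd hΩ hc f) (scaledGradNewton hd hΩ hc f) ≤
      (C / c₀) ^ 2 * weightedInner f f := by
  refine weightedInner_self_le_of_norm_le hT ?_
  filter_upwards [scaledGradNewton_ae hd hΩ hc f] with s h1
  rw [h1]
  exact norm_scaledGrad_newton_le hd hΩ hc hC _

lemma scaledGradNewton_neg_add_smul (a : ℝ) (f g : TimeL2 T (L2 Ω)) :
    scaledGradNewton hd hΩ hc (-f + a • g) =
      -scaledGradNewton hd hΩ hc f + a • scaledGradNewton hd hΩ hc g := by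
  simp only [scaledGradNewton, timeMap_add, timeMap_smul, timeMap_neg]

end Forms

end WaveInfSup

end

/-! ### The inf-sup estimate -/

open WaveInfSup

set_option maxHeartbeats 1000000 in
theorem mainTheorem2 {d : ℕ} (hd : 0 < d) {Ω : Set (WaveInfSup.Vec d)} (hΩo : IsOpen Ω)
    (hΩ : Bornology.IsBounded Ω) {c : WaveInfSup.Vec d → ℝ} {c₀ : ℝ}
    (hc : WaveInfSup.IsWaveSpeed Ω c c₀) {T : ℝ} (hT : 0 < T)
    {C : ℝ} (hC : WaveInfSup.IsPoincareConst Ω C)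
    (U : WaveInfSup.TimeL2 T (WaveInfSup.H10 Ω)) (V : WaveInfSup.TimeL2 T (WaveInfSup.L2 Ω))
    (hU : WaveInfSup.MemH1Zero U) (hV : WaveInfSup.MemH1Zero V) (hUV : ¬(U = 0 ∧ V = 0)) :
    ∃ (lam : WaveInfSup.TimeL2 T (WaveInfSup.H10 Ω)) (chi : WaveInfSup.TimeL2 T (WaveInfSup.L2 Ω)),
      chi = -(WaveInfSup.timeMap (WaveInfSup.toL2 Ω) (WaveInfSup.timeDeriv U))
        + (2 * T) • WaveInfSup.timeDeriv V ∧
      lam = WaveInfSup.timeMap (WaveInfSup.newton hd hΩ hc)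
          (WaveInfSup.timeMap (Y := WaveInfSup.H10Dual Ω) (WaveInfSup.toDual Ω) (WaveInfSup.timeDeriv V))
        + (2 * T) • WaveInfSup.timeDeriv U ∧
      0 < WaveInfSup.normV hd hΩ hc U V ∧
      0 < WaveInfSup.normW hd hΩ hc lam chi ∧
      1 / (2 * Real.sqrt (C ^ 2 / c₀ ^ 2 + 4 * T ^ 2)) ≤
        WaveInfSup.bilinA c U V lam chi /
          (WaveInfSup.normV hd hΩ hc U V * WaveInfSup.normW hd hΩ hc lam chi) := by
  refine ⟨_, _, rfl, rfl, ?_⟩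
  -- `p` and `q` are the time derivatives, `n = N q`, `m` is `n` in `L²(Q_T)`, and `L` is `c ∇`
  obtain ⟨p, hp⟩ : ∃ p, p = timeMap (toL2 Ω) (timeDeriv U) := ⟨_, rfl⟩
  obtain ⟨q, hq⟩ : ∃ q, q = timeDeriv V := ⟨_, rfl⟩
  obtain ⟨n, hn⟩ : ∃ n, n = timeMap (newton hd hΩ hc)
      (timeMap (Y := H10Dual Ω) (toDual Ω) q) := ⟨_, rfl⟩
  obtain ⟨m, hm⟩ : ∃ m, m = timeMap (toL2 Ω) n := ⟨_, rfl⟩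
  obtain ⟨Ln, hLn⟩ : ∃ Ln, Ln = timeMap (scaledGrad hc.memLp) n := ⟨_, rfl⟩
  have hLn' : scaledGradNewton hd hΩ hc q = Ln := by rw [hLn, hn, scaledGradNewton]
  obtain ⟨Lk, hLk⟩ : ∃ Lk, Lk = scaledGradNewton hd hΩ hc p := ⟨_, rfl⟩
  obtain ⟨Lu, hLu⟩ : ∃ Lu, Lu = timeMap (scaledGrad hc.memLp) U := ⟨_, rfl⟩
  have hqm : weightedInner q m = weightedInner Ln Ln := by
    rw [hm, ← weightedInner_scaledGradNewton hd hΩ hc, hLn', hLn]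
  have hpm : weightedInner p m = weightedInner Lk Ln := by
    rw [hm, ← weightedInner_scaledGradNewton hd hΩ hc, hLk, hLn]
  have hUe := hU.weightedInner_self_le hT (scaledGrad hc.memLp)
  have hVe := hV.weightedInner_self_le hT (ContinuousLinearMap.id ℝ (L2 Ω))
  rw [timeMap_id, timeMap_id, ← hq] at hVe
  have hmle := weightedInner_timeMap_toL2_le hc hT hC n
  have hkle := weightedInner_scaledGradNewton_le hd hΩ hc hT hC p
  have hpos := weightedInner_derivatives_pos hd hΩ hc hΩo hT hU hV hUV
  have hnormV := normV_eq hd hΩ hc hU hV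
  have hnormW := normW_eq hd hΩ hc (n + (2 * T) • timeDeriv U) (-p + (2 * T) • q)
  have hA := bilinA_eq hc hU hV (n + (2 * T) • timeDeriv U) (-p + (2 * T) • q)
  rw [← hLu] at hUe
  rw [← hm, ← hLn, div_pow] at hmle
  rw [← hLk, div_pow] at hkle
  rw [← hp, ← hq, hLn'] at hpos
  rw [← hp, ← hq, hLn', ← hLu] at hnormV
  rw [scaledGradNewton_neg_add_smul, hLn', ← hLk, timeMap_add, timeMap_smul, ← hp, ← hm,
    weightedInner_test_add hT hpm] at hnormW
  rw [timeMap_add, timeMap_smul, timeMap_add, timeMap_smul, ← hp, ← hq, ← hm, ← hLn, ← hLu] at hA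
  rw [← hp, ← hq, ← hn, hnormV, hnormW]
  have hu0 := weightedInner_self_nonneg Lu
  have hv0 := weightedInner_self_nonneg V
  have hm0 := weightedInner_self_nonneg m
  have hk0 := weightedInner_self_nonneg Lk
  have hV2 : 0 < weightedInner p p + weightedInner Ln Ln + weightedInner Lu Lu
      + weightedInner V V := by linarith
  have hW2 : 0 < weightedInner m m + 4 * T ^ 2 * weightedInner p p + weightedInner Lk Lk
      + 4 * T ^ 2 * weightedInner Ln Ln := by
    have := mul_pos (pow_pos hT 2) hpos
    linarith
  have hK : 0 < C ^ 2 / c₀ ^ 2 + 4 * T ^ 2 := by positivity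
  refine ⟨Real.sqrt_pos.2 hV2, Real.sqrt_pos.2 hW2,
    one_div_le_div_sqrt_mul_sqrt hV2 hW2 hK ?_ ?_⟩
  · rw [hA]
    exact half_le_of_energy hT hqm hUe hVe
  · calc _ ≤ (C ^ 2 / c₀ ^ 2 + 4 * T ^ 2) * (weightedInner p p + weightedInner Ln Ln) := by
          linarith
      _ ≤ _ := mul_le_mul_of_nonneg_left (by linarith) hK.le
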